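/- **Setting.** Formulas are generated from a countably infinite set of propositional variables and $\bot$ by $\wedge,\vee,\to,\Diamond,\Box$, with $\neg\varphi:=\varphi\to\bot$. The logic $\mathsf{S4I}$ is the smallest set of formulas that is closed under substitution, modus ponens and necessitation (from $\varphi$ infer $\Box\varphi$) and contains all intuitionistic tautologies and the axioms $$\Box(p\to q)\to(\Box p\to\Box q),\quad \Box(p\to q)\to(\Diamond p\to\Diamond q),\quad \Box p\to p,\quad p\to\Diamond p,\quad \Box p\to\Box\Box p,\quad \Diamond\Diamond p\to\Diamond p,$$ $$\Diamond(p\vee q)\to\Diamond p\vee\Diamond q,\quad \neg\Diamond\bot,\quad \Box(p\vee q)\to\Box p\vee\Diamond q.$$ An $\mathsf{S4I}$ frame is a triple $(W,\preccurlyeq,\sqsubseteq)$ where $\preccurlyeq$ and $\sqsubseteq$ are preorders on the set $W$ such that - (forth–up confluence) if $w\preccurlyeq w'$ and $w\sqsubseteq v$, then there is $v'$ with $v\preccurlyeq v'$ and $w'\sqsubseteq v'$; - (forth–down confluence) if $w\preccurlyeq v\sqsubseteq v'$, then there is $w'$ with $w\sqsubseteq w'\preccurlyeq v'$. A valuation $V$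 assigns to each variable a $\preccurlyeq$-upward closed subset of $W$. Satisfaction at a world $w$ is defined as usual for variables, $\wedge$, $\vee$, with $\bot$ satisfied nowhere, and: $w\models\varphi\to\psi$ iff for all $v\succcurlyeq w$, $v\models\varphi$ implies $v\models\psi$; $w\models\Diamond\varphi$ iff for all $u\succcurlyeq w$ there is $v\sqsupseteq u$ with $v\models\varphi$; $w\models\Box\varphi$ iff $v\models\varphi$ for all $u,v$ with $w\preccurlyeq u\sqsubseteq v$. A formula is falsifiable (respectively satisfiable) on a frame if, under some valuation on it, it fails (respectively holds) at some world. **Theorem.** $\mathsf{S4I}$ has the finite frame property: if a formula $\varphi$ is falsifiable (respectively satisfiable) on an $\mathsf{S4I}$ frame, then $\varphi$ is falsifiable (respectively satisfiable) on a finite $\mathsf{S4I}$ frame. Moreover, the logic $\mathsf{S4I}$ is decidable, that is, there is an algorithm deciding, given a formula $\varphi$, whether $\varphi\in\mathsf{S4I}$. -/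

import Mathlib

universe u v

namespace IntModal

/-- The intuitionistic modal language over the countably infinite set `ℕ` of variables. -/
inductive Formula : Type where
  | var : ℕ → Formula
  | bot : Formula
  | and : Formula → Formula → Formula
  | or : Formula → Formula → Formula
  | imp : Formula → Formula → Formula
  | dia : Formula → Formula
  | box : Formula → Formula

namespace Formula

/-- Negation is shorthand for implication of falsum. -/
def neg (φ : Formula) : Formula := imp φ bot

/-- Uniform substitution of formulas for propositional variables. -/
def subst (σ : ℕ → Formula) : Formula → Formula
  | var n => σ n
  | bot => bot
  | and φ ψ => and (subst σ φ) (subst σ ψ)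
  | or φ ψ => or (subst σ φ) (subst σ ψ)
  | imp φ ψ => imp (subst σ φ) (subst σ ψ)
  | dia φ => dia (subst σ φ)
  | box φ => box (subst σ φ)

/-- The standard numerical code of a formula: a tag for the main connective, paired with the code
of the immediate constituents. -/
def code : Formula → ℕ
  | var n => Nat.pair 0 n
  | bot => Nat.pair 1 0
  | and φ ψ => Nat.pair 2 (Nat.pair (code φ) (code ψ))
  | or φ ψ => Nat.pair 3 (Nat.pair (code φ) (code ψ))
  | imp φ ψ => Nat.pair 4 (Nat.pair (code φ) (code ψ))
  | dia φ => Nat.pair 5 (code φ)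
  | box φ => Nat.pair 6 (code φ)

theorem code_injective : Function.Injective code := by
  intro φ
  induction φ with
  | var n => intro ψ h; cases ψ <;> simp_all [code, Nat.pair_eq_pair]
  | bot => intro ψ h; cases ψ <;> simp_all [code, Nat.pair_eq_pair]
  | and a b iha ihb =>
    intro ψ h
    cases ψ <;> simp [code, Nat.pair_eq_pair] at h ⊢
    exact ⟨iha h.1, ihb h.2⟩
  | or a b iha ihb =>
    intro ψ h
    cases ψ <;> simp [code, Nat.pair_eq_pair] at h ⊢
    exact ⟨iha h.1, ihb h.2⟩
  | imp a b iha ihb =>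
    intro ψ h
    cases ψ <;> simp [code, Nat.pair_eq_pair] at h ⊢
    exact ⟨iha h.1, ihb h.2⟩
  | dia a iha =>
    intro ψ h
    cases ψ <;> simp [code, Nat.pair_eq_pair] at h ⊢
    exact iha h
  | box a iha =>
    intro ψ h
    cases ψ <;> simp [code, Nat.pair_eq_pair] at h ⊢
    exact iha h

end Formula

open Formula

/-- A set of formulas is decidable when the set of codes of its members is a computable set of
natural numbers. -/
def DecidableLogic (L : Set Formula) : Prop :=
  ComputablePred fun n : ℕ => ∃ φ ∈ L, φ.code = n

/-! ### Deductive calculus -/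

/-- Hilbert axiom schemes which, with modus ponens, give intuitionistic propositional logic. -/
inductive IntAxiom : Formula → Prop
  | k (φ ψ : Formula) : IntAxiom (imp φ (imp ψ φ))
  | s (φ ψ χ : Formula) :
      IntAxiom (imp (imp φ (imp ψ χ)) (imp (imp φ ψ) (imp φ χ)))
  | andIntro (φ ψ : Formula) : IntAxiom (imp φ (imp ψ (and φ ψ)))
  | andLeft (φ ψ : Formula) : IntAxiom (imp (and φ ψ) φ)
  | andRight (φ ψ : Formula) : IntAxiom (imp (and φ ψ) ψ)
  | orLeft (φ ψ : Formula) : IntAxiom (imp φ (or φ ψ))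
  | orRight (φ ψ : Formula) : IntAxiom (imp ψ (or φ ψ))
  | orElim (φ ψ χ : Formula) :
      IntAxiom (imp (imp φ χ) (imp (imp ψ χ) (imp (or φ ψ) χ)))
  | exFalso (φ : Formula) : IntAxiom (imp bot φ)

/-- The modal axiom schemes of `CS4`. -/
inductive CS4Axiom : Formula → Prop
  | kBox (φ ψ : Formula) : CS4Axiom (imp (box (imp φ ψ)) (imp (box φ) (box ψ)))
  | kDia (φ ψ : Formula) : CS4Axiom (imp (box (imp φ ψ)) (imp (dia φ) (dia ψ)))
  | tBox (φ : Formula) : CS4Axiom (imp (box φ) φ)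
  | tDia (φ : Formula) : CS4Axiom (imp φ (dia φ))
  | fourBox (φ : Formula) : CS4Axiom (imp (box φ) (box (box φ)))
  | fourDia (φ : Formula) : CS4Axiom (imp (dia (dia φ)) (dia φ))

/-- The additional axiom schemes `DP`, `N`, `CD` of `S4I`. -/
inductive S4IAxiom : Formula → Prop
  | dp (φ ψ : Formula) : S4IAxiom (imp (dia (or φ ψ)) (or (dia φ) (dia ψ)))
  | n : S4IAxiom (neg (dia bot))
  | cd (φ ψ : Formula) : S4IAxiom (imp (box (or φ ψ)) (or (box φ) (dia ψ)))

/-- Derivability in the Hilbert calculus for `S4I`: intuitionistic logic, the axioms of `CS4`, the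
axioms `DP`, `N`, `CD`, modus ponens and necessitation. -/
inductive S4IDerivable : Formula → Prop
  | int {φ : Formula} : IntAxiom φ → S4IDerivable φ
  | cs4 {φ : Formula} : CS4Axiom φ → S4IDerivable φ
  | s4i {φ : Formula} : S4IAxiom φ → S4IDerivable φ
  | mp {φ ψ : Formula} : S4IDerivable (imp φ ψ) → S4IDerivable φ → S4IDerivable ψ
  | nec {φ : Formula} : S4IDerivable φ → S4IDerivable (box φ)

/-- The logic `S4I`, as a set of formulas. -/
def S4I : Set Formula := {φ | S4IDerivable φ}

/-- `S4I` is closed under substitution; the schematic axioms make a substitution rule redundant. -/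
theorem S4I_closed_subst (σ : ℕ → Formula) {φ : Formula} (h : φ ∈ S4I) : φ.subst σ ∈ S4I := by
  change S4IDerivable _ at h
  change S4IDerivable _
  induction h with
  | int h => exact .int (by cases h <;> constructor)
  | cs4 h => exact .cs4 (by cases h <;> constructor)
  | s4i h => exact .s4i (by cases h <;> constructor)
  | mp _ _ ih₁ ih₂ => exact .mp ih₁ ih₂
  | nec _ ih => exact .nec ih

/-! ### Birelational semantics -/

/-- Bi-intuitionistic frames `(W, W^⊥, ≼, ⊑)`: both relations are preorders, and the set of
fallible worlds is closed under both. -/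
structure BiIntFrame (W : Type u) where
  fallible : Set W
  le : W → W → Prop
  acc : W → W → Prop
  le_refl : ∀ w, le w w
  le_trans : ∀ w v z, le w v → le v z → le w z
  acc_refl : ∀ w, acc w w
  acc_trans : ∀ w v z, acc w v → acc v z → acc w z
  fallible_le : ∀ w v, w ∈ fallible → le w v → v ∈ fallible
  fallible_acc : ∀ w v, w ∈ fallible → acc w v → v ∈ fallible

namespace BiIntFrame

variable {W : Type u}

def ForthUpConfluent (F : BiIntFrame W) : Prop :=
  ∀ w w' z, F.le w w' → F.acc w z → ∃ z', F.le z z' ∧ F.acc w' z'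

def ForthDownConfluent (F : BiIntFrame W) : Prop :=
  ∀ w z z', F.le w z → F.acc z z' → ∃ w', F.acc w w' ∧ F.le w' z'

def Infallible (F : BiIntFrame W) : Prop := F.fallible = ∅

end BiIntFrame

/-- Valuations: each `V p` is upward closed for `≼` and contains the fallible worlds. -/
structure Valuation {W : Type u} (F : BiIntFrame W) where
  val : ℕ → Set W
  monotone : ∀ p w v, w ∈ val p → F.le w v → v ∈ val p
  fallible_subset : ∀ p, F.fallible ⊆ val p

/-- Satisfaction of a formula at a world of a bi-intuitionistic model. -/
def Sat {W : Type u} (F : BiIntFrame W) (V : Valuation F) : W → Formula → Prop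
  | w, .var p => w ∈ V.val p
  | w, .bot => w ∈ F.fallible
  | w, .and φ ψ => Sat F V w φ ∧ Sat F V w ψ
  | w, .or φ ψ => Sat F V w φ ∨ Sat F V w ψ
  | w, .imp φ ψ => ∀ z, F.le w z → Sat F V z φ → Sat F V z ψ
  | w, .dia φ => ∀ z, F.le w z → ∃ y, F.acc z y ∧ Sat F V y φ
  | w, .box φ => ∀ z y, F.le w z → F.acc z y → Sat F V y φ

/-- A class of bi-intuitionistic frames (with worlds in a given universe). -/
def FrameClass : Type (u + 1) := ∀ W : Type u, BiIntFrame W → Prop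

/-- Local semantic consequence over a class of frames. -/
def Consequence (S : FrameClass.{u}) (Γ : Set Formula) (φ : Formula) : Prop :=
  ∀ (W : Type u) (F : BiIntFrame W), S W F → ∀ (V : Valuation F) (w : W), w ∉ F.fallible →
    (∀ ψ ∈ Γ, Sat F V w ψ) → Sat F V w φ

def Valid (S : FrameClass.{u}) (φ : Formula) : Prop := Consequence S ∅ φ

def Falsifiable (S : FrameClass.{u}) (φ : Formula) : Prop := ¬ Valid S φ

def Satisfiable (S : FrameClass.{u}) (φ : Formula) : Prop := ¬ Consequence S {φ} bot

/-- `S4I` frames: forth-up and forth-down confluent, infallible bi-intuitionistic frames. -/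
def S4IFrames : FrameClass.{u} := fun _ F =>
  F.ForthUpConfluent ∧ F.ForthDownConfluent ∧ F.Infallible

/-- `S4I` frames with finitely many worlds. -/
def FiniteS4IFrames : FrameClass.{u} := fun W F => Finite W ∧ S4IFrames W F

end IntModal

/-!
The finite frame property is proved by rebuilding a given model from finitely many labelled trees.
Forth-up and forth-down confluence make both modalities local (`sat_dia_iff`, `sat_box_iff`), so
that a world `w` satisfies `◇φ` or `□φ` according to its modal successors alone. Label every world
with the subformulas of the given formula `φ` that it satisfies. Labels grow along the intuitionistic
order, hence only boundedly often, and worlds have finitely many *shapes*: the shape of `w` records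
its label and the shapes of the worlds above it with a larger label (`exists_finite_shape`). The
worlds of the finite model are the paths through the shapes. A path has no repetition, so there are
finitely many of them, and extension of paths is the intuitionistic order.

Two paths `s` and `t` are related by the modal relation if `t = f s` for some map `f` of paths which
preserves extension and moves each path to one with a coherent label (`IsPathMap`). Such maps
contain the identity and are closed under composition, which makes the relation a preorder, and both
confluence conditions hold at once, by applying the same `f` to both ends of an extension. What is
left is to match each modal step `w ⊑ v` of the given model by a map (`exists_pathMap`). The tree of
paths starting at a fixed shape is realized by worlds (`exists_realization`); a step at one node
propagates down to the root by forth-down confluence, and from there to all nodes by forth-up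
confluence (`exists_lift`); reading off the shapes in the propagated tree, and skipping steps at
which the label does not change (`shapePath`), gives the map.

For decidability, the canonical model of prime theories is an `S4I` model. The axiom `CD` yields its
forth-down confluence and the axiom `DP` its forth-up confluence. Together with the finite frame
property, `S4I` consists of the formulas that hold in all finite `S4I` models (`mem_S4I_iff`).
Derivations and finite countermodels are finite tables whose correctness is a primitive recursive
condition, so `S4I` and its complement are both recursively enumerable, and Post's theorem applies.
-/

namespace IntModal

open Formula

/-! ### Finite shapes of upward cones -/

/-- A monotone labelling of a preorder by subsets of a finite set factors, up to iterating strict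
growth of labels, through a finite type: `U w` determines the label of `w` and the values of `U`
at all points above `w` whose label is strictly larger. The values of `U` are refined step by
step, and the refinement is stable at `w` after as many steps as the label of `w` can still
grow. -/
theorem exists_finite_shape {W : Type u} {α : Type} {S : Set α} (hS : S.Finite)
    (le : W → W → Prop) (lab : W → Set α) (hsub : ∀ w, lab w ⊆ S)
    (hmono : ∀ w v, le w v → lab w ⊆ lab v) :
    ∃ (H : Type v) (_ : Finite H) (U : W → H), ∀ w w', U w = U w' → lab w = lab w' ∧
      ∀ v, le w v → lab v ≠ lab w → ∃ v', le w' v' ∧ lab v' ≠ lab w' ∧ U v' = U v := by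
  have key : ∀ n : ℕ, ∃ (H : Type v) (_ : Finite H) (U : W → H), ∀ w w', U w = U w' →
      lab w = lab w' ∧ ((S \ lab w).ncard < n →
        ∀ v, le w v → lab v ≠ lab w → ∃ v', le w' v' ∧ lab v' ≠ lab w' ∧ U v' = U v) := by
    intro n
    induction n with
    | zero =>
      have : Finite {s : Set α // s ⊆ S} := hS.finite_subsets.to_subtype
      refine ⟨ULift {s : Set α // s ⊆ S}, inferInstance, fun w => ⟨lab w, hsub w⟩, ?_⟩
      intro w w' h
      exact ⟨congrArg (·.down.1) h, fun h => absurd h (Nat.not_lt_zero _)⟩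
    | succ n ih =>
      obtain ⟨H, hH, U, hU⟩ := ih
      refine ⟨H × Set H, inferInstance,
        fun w => (U w, {h | ∃ v, le w v ∧ lab v ≠ lab w ∧ U v = h}), ?_⟩
      intro w w' h
      obtain ⟨h1, h2⟩ := Prod.mk.inj h
      refine ⟨(hU _ _ h1).1, fun hn v hv hne => ?_⟩
      have hmem : U v ∈ {h | ∃ v, le w v ∧ lab v ≠ lab w ∧ U v = h} := ⟨v, hv, hne, rfl⟩
      rw [h2] at hmem
      obtain ⟨v', hv', hne', e⟩ := hmem
      refine ⟨v', hv', hne', Prod.ext e ?_⟩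
      -- The label of `v` can grow less often than that of `w`, so `U` is already stable at `v`.
      have hlt : (S \ lab v).ncard < n := by
        have : (S \ lab v).ncard < (S \ lab w).ncard := by
          refine Set.ncard_lt_ncard ⟨Set.sdiff_subset_sdiff_right (hmono _ _ hv), fun hss => ?_⟩
            hS.sdiff
          refine hne (Set.Subset.antisymm (fun a ha => ?_) (hmono _ _ hv))
          by_contra hna
          exact (hss ⟨hsub _ ha, hna⟩).2 ha
        omega
      have hlt' : (S \ lab v').ncard < n := by rwa [(hU _ _ e).1]
      ext k
      constructor
      · rintro ⟨z, hz, hzn, rfl⟩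
        exact (hU _ _ e).2 hlt' z hz hzn
      · rintro ⟨z, hz, hzn, rfl⟩
        exact (hU _ _ e.symm).2 hlt z hz hzn
  obtain ⟨H, hH, U, hU⟩ := key (S.ncard + 1)
  refine ⟨H, hH, U, fun w w' h => ⟨(hU w w' h).1, (hU w w' h).2 ?_⟩⟩
  exact Nat.lt_succ_of_le (Set.ncard_le_ncard Set.sdiff_subset hS)

/-! ### Paths through the shapes -/

section Paths

variable {W : Type u} {H : Type v} {α : Type}

/-- One shape leads to another if some point of the first shape lies below a point of the second
with a different label. -/
def ShapeStep (le : W → W → Prop) (lab : W → Set α) (U : W → H) (h h' : H) : Prop :=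
  ∃ w v, le w v ∧ lab v ≠ lab w ∧ U w = h ∧ U v = h'

/-- A path of shapes, listed from its end to its root: consecutive shapes are linked by
`ShapeStep`, and the root is the shape of a point. In particular, a path is not empty. -/
def IsPath (le : W → W → Prop) (lab : W → Set α) (U : W → H) (l : List H) : Prop :=
  l.IsChain (fun b a => ShapeStep le lab U a b) ∧ ∃ w, l.getLast? = some (U w)

/-- The label of a path is the label of the points whose shape is the end of the path. -/
def pathLabel (lab : W → Set α) (U : W → H) (l : List H) : Set α :=
  {a | ∃ w, l.head? = some (U w) ∧ a ∈ lab w}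

variable {le : W → W → Prop} {lab : W → Set α} {U : W → H}

theorem pathLabel_cons (hU : ∀ w w', U w = U w' → lab w = lab w') (w : W) (t : List H) :
    pathLabel lab U (U w :: t) = lab w := by
  ext a
  constructor
  · rintro ⟨v, hv, ha⟩
    simp only [List.head?_cons, Option.some.injEq] at hv
    rwa [hU _ _ hv]
  · intro ha
    exact ⟨w, rfl, ha⟩

theorem IsPath.exists_head {l : List H} (hl : IsPath le lab U l) :
    ∃ w t, l = U w :: t := by
  obtain ⟨hc, w, hw⟩ := hl
  match l, hc, hw with
  | [h], _, hw => exact ⟨w, [], by simpa using hw⟩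
  | h :: h' :: t, hc, _ =>
    obtain ⟨_, v, _, _, _, rfl⟩ := (List.isChain_cons_cons.1 hc).1
    exact ⟨v, _, rfl⟩

theorem IsPath.tail {h h' : H} {t : List H} (hl : IsPath le lab U (h :: h' :: t)) :
    IsPath le lab U (h' :: t) :=
  ⟨(List.isChain_cons_cons.1 hl.1).2, by simpa using hl.2⟩

theorem IsPath.cons {h h' : H} {t : List H} (hl : IsPath le lab U (h' :: t))
    (hs : ShapeStep le lab U h' h) : IsPath le lab U (h :: h' :: t) :=
  ⟨List.isChain_cons_cons.2 ⟨hs, hl.1⟩, by simpa using hl.2⟩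

theorem isPath_singleton (w : W) : IsPath le lab U [U w] :=
  ⟨List.isChain_singleton _, w, rfl⟩

theorem pathLabel_mono (hmono : ∀ w v, le w v → lab w ⊆ lab v)
    (hU : ∀ w w', U w = U w' → lab w = lab w') {s t : List H} (ht : IsPath le lab U t)
    (hs : IsPath le lab U s) (hst : s <:+ t) : pathLabel lab U s ⊆ pathLabel lab U t := by
  induction t with
  | nil => obtain ⟨w, t, h⟩ := ht.exists_head; simp at h
  | cons h t ih =>
    rcases List.suffix_cons_iff.1 hst with rfl | hst
    · exact subset_rfl
    · cases t with
      | nil =>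
        obtain ⟨w, t, h⟩ := hs.exists_head
        rw [List.suffix_nil.1 hst] at h
        simp at h
      | cons h' t =>
        refine (ih ht.tail hst).trans ?_
        obtain ⟨w, v, hwv, -, rfl, rfl⟩ := (List.isChain_cons_cons.1 ht.1).1
        rw [pathLabel_cons hU, pathLabel_cons hU]
        exact hmono _ _ hwv

/-- Labels grow strictly along a path, so a path has no repetitions. -/
theorem IsPath.nodup (hmono : ∀ w v, le w v → lab w ⊆ lab v)
    (hU : ∀ w w', U w = U w' → lab w = lab w') {l : List H} (hl : IsPath le lab U l) :
    l.Nodup := by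
  have h1 : l.IsChain (fun b a => pathLabel lab U [a] ⊂ pathLabel lab U [b]) := by
    refine hl.1.imp ?_
    rintro b a ⟨w, v, hwv, hne, rfl, rfl⟩
    rw [pathLabel_cons hU, pathLabel_cons hU]
    exact (hmono _ _ hwv).ssubset_of_ne hne.symm
  have : IsTrans H (fun b a => pathLabel lab U [a] ⊂ pathLabel lab U [b]) :=
    ⟨fun _ _ _ h h' => h'.trans h⟩
  exact h1.pairwise.imp fun h e => by subst e; exact (ssubset_irrefl _ h)

theorem finite_paths [Finite H] (hmono : ∀ w v, le w v → lab w ⊆ lab v)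
    (hU : ∀ w w', U w = U w' → lab w = lab w') : Finite {l : List H // IsPath le lab U l} := by
  classical
  have := Fintype.ofFinite H
  exact Finite.of_injective (β := {l : List H // l.Nodup})
    (fun l => ⟨l.1, l.2.nodup hmono hU⟩) fun a b h => Subtype.ext (congrArg (·.1) h)

/-- The path of shapes passed by a function on lists, monotone for the extension order, on the way
from the empty list to a given list. Steps which leave the label unchanged are dropped. -/
noncomputable def shapePath (lab : W → Set α) (U : W → H) {β : Type v} (v : List β → W) :
    List β → List H
  | [] => [U (v [])]
  | b :: t =>
    open Classical in
    if lab (v (b :: t)) = lab (v t) then shapePath lab U v t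
    else U (v (b :: t)) :: shapePath lab U v t

/-- Along `shapePath`, the end of the path is the shape of a point with the label of the current
value, but possibly strictly below it. -/
theorem shapePath_spec (hrefl : ∀ w, le w w) (htrans : ∀ w v z, le w v → le v z → le w z)
    {β : Type v} {v : List β → W} (hv : ∀ b t, le (v t) (v (b :: t))) (s : List β) :
    IsPath le lab U (shapePath lab U v s) ∧
      ∃ x t, shapePath lab U v s = U x :: t ∧ lab x = lab (v s) ∧ le x (v s) := by
  induction s with
  | nil => exact ⟨isPath_singleton _, v [], [], rfl, rfl, hrefl _⟩
  | cons b s ih =>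
    obtain ⟨hp, x, t, hx, hl, hle⟩ := ih
    have hle' := htrans _ _ _ hle (hv b s)
    rw [shapePath]
    split_ifs with h
    · exact ⟨hp, x, t, hx, hl.trans h.symm, hle'⟩
    · refine ⟨?_, _, _, rfl, rfl, hrefl _⟩
      rw [hx] at hp ⊢
      exact hp.cons ⟨x, _, hle', by rwa [hl], rfl, rfl⟩

theorem shapePath_suffix {β : Type v} (v : List β → W) {s t : List β} (hst : s <:+ t) :
    shapePath lab U v s <:+ shapePath lab U v t := by
  induction t with
  | nil => rw [List.suffix_nil.1 hst]
  | cons b t ih =>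
    rcases List.suffix_cons_iff.1 hst with rfl | hst
    · exact List.suffix_rfl
    · refine (ih hst).trans ?_
      rw [shapePath]
      split_ifs
      · exact List.suffix_rfl
      · exact List.suffix_cons _ _

/-- Every shape that is the end of a path with the shape of `w₀` as its root is realized by a
point above `w₀`, coherently along extensions of paths. -/
theorem exists_realization (hrefl : ∀ w, le w w)
    (hU : ∀ w w', U w = U w' → lab w = lab w' ∧
      ∀ v, le w v → lab v ≠ lab w → ∃ v', le w' v' ∧ lab v' ≠ lab w' ∧ U v' = U v) (w₀ : W) :
    ∃ g : List H → W, (∀ h t, le (g t) (g (h :: t))) ∧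
      ∀ l, IsPath le lab U l → l.getLast? = some (U w₀) → l.head? = some (U (g l)) := by
  classical
  -- Where no point of the next shape lies strictly above, the value of the tail is kept.
  obtain ⟨g, hg₀, hg⟩ : ∃ g : List H → W, g [] = w₀ ∧ ∀ h t, g (h :: t) =
      if hx : ∃ v, le (g t) v ∧ lab v ≠ lab (g t) ∧ U v = h then hx.choose else g t :=
    ⟨fun l => List.rec w₀ (fun h _ x =>
      if hx : ∃ v, le x v ∧ lab v ≠ lab x ∧ U v = h then hx.choose else x) l,
      rfl, fun _ _ => rfl⟩
  refine ⟨g, fun h t => ?_, fun l hl hlast => ?_⟩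
  · rw [hg]
    split_ifs with hx
    · exact hx.choose_spec.1
    · exact hrefl _
  · induction l with
    | nil => simp at hlast
    | cons h t ih =>
      cases t with
      | nil =>
        simp only [List.getLast?_singleton, Option.some.injEq] at hlast
        subst hlast
        rw [hg, dif_neg, hg₀]
        · rfl
        · rw [hg₀]
          rintro ⟨v, -, hne, he⟩
          exact hne (hU _ _ he).1
      | cons h' t =>
        have hh' := ih hl.tail (by simpa using hlast)
        simp only [List.head?_cons, Option.some.injEq] at hh'
        have hx : ∃ v, le (g (h' :: t)) v ∧ lab v ≠ lab (g (h' :: t)) ∧ U v = h := by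
          obtain ⟨w, v, hwv, hne, hw, rfl⟩ := (List.isChain_cons_cons.1 hl.1).1
          exact (hU w _ (hw.trans hh')).2 v hwv hne
        rw [hg, dif_pos hx]
        simp [hx.choose_spec.2.2]

end Paths

/-! ### Lifting a modal step along a tree -/

/-- In a confluent frame, a modal step from one value of a monotone function on lists extends to
modal steps from all its values. Forth-down confluence gives the steps at the suffixes of `p`,
forth-up confluence those at all other lists. -/
theorem exists_lift {W : Type u} {β : Type v} {F : BiIntFrame W} (hup : F.ForthUpConfluent)
    (hdown : F.ForthDownConfluent) {g : List β → W} (hg : ∀ b t, F.le (g t) (g (b :: t)))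
    (p : List β) (v : W) (hv : F.acc (g p) v) :
    ∃ f : List β → W, f p = v ∧ (∀ s, F.acc (g s) (f s)) ∧ ∀ b t, F.le (f t) (f (b :: t)) := by
  classical
  have h1 : ∃ a : List β → W, a p = v ∧ (∀ s, s <:+ p → F.acc (g s) (a s)) ∧
      ∀ b t, b :: t <:+ p → F.le (a t) (a (b :: t)) := by
    induction p generalizing v with
    | nil =>
      refine ⟨fun _ => v, rfl, fun s hs => ?_, fun _ _ _ => F.le_refl _⟩
      rwa [List.suffix_nil.1 hs]
    | cons b t ih =>
      obtain ⟨y, hy, hyv⟩ := hdown _ _ _ (hg b t) hv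
      obtain ⟨a, ha, ha1, ha2⟩ := ih y hy
      have hne : ∀ s, s <:+ t → s ≠ b :: t := by
        rintro s hs rfl
        have := hs.length_le
        simp at this
      -- The lift through `t` of the step found at `t` by confluence is extended by `v` at `b :: t`.
      refine ⟨fun s => if s = b :: t then v else a s, if_pos rfl, fun s hs => ?_,
        fun c s hs => ?_⟩
      · rcases List.suffix_cons_iff.1 hs with rfl | hs
        · simpa using hv
        · simpa only [if_neg (hne s hs)] using ha1 s hs
      · rcases List.suffix_cons_iff.1 hs with e | hs
        · obtain ⟨rfl, rfl⟩ := List.cons.inj e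
          simpa only [if_neg (hne s List.suffix_rfl), if_true, ha] using hyv
        · simpa only [if_neg (hne _ hs), if_neg (hne s ((List.suffix_cons c s).trans hs))]
            using ha2 c s hs
  obtain ⟨a, hap, ha1, ha2⟩ := h1
  obtain ⟨f, hf₀, hf⟩ : ∃ f : List β → W, f [] = a [] ∧ ∀ b t, f (b :: t) =
      if b :: t <:+ p then a (b :: t)
      else if hx : ∃ z, F.le (f t) z ∧ F.acc (g (b :: t)) z then hx.choose else f t :=
    ⟨fun l => List.rec (a []) (fun b t x =>
      if b :: t <:+ p then a (b :: t)
      else if hx : ∃ z, F.le x z ∧ F.acc (g (b :: t)) z then hx.choose else x) l,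
      rfl, fun _ _ => rfl⟩
  have hfa : ∀ s, s <:+ p → f s = a s := by
    intro s hs
    cases s with
    | nil => exact hf₀
    | cons b t => rw [hf, if_pos hs]
  have step : ∀ s, F.acc (g s) (f s) → ∀ b, F.le (f s) (f (b :: s)) ∧
      F.acc (g (b :: s)) (f (b :: s)) := by
    intro s hs b
    by_cases hb : b :: s <:+ p
    · rw [hfa _ hb, hfa s ((List.suffix_cons b s).trans hb)]
      exact ⟨ha2 b s hb, ha1 _ hb⟩
    · have hx : ∃ z, F.le (f s) z ∧ F.acc (g (b :: s)) z := hup _ _ _ (hg b s) hs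
      rw [hf, if_neg hb, dif_pos hx]
      exact hx.choose_spec
  have hacc : ∀ s, F.acc (g s) (f s) := by
    intro s
    induction s with
    | nil => rw [hf₀]; exact ha1 _ List.nil_suffix
    | cons c s ih => exact (step s ih c).2
  exact ⟨f, (hfa p List.suffix_rfl).trans hap, hacc, fun b s => (step s (hacc s) b).1⟩

/-! ### Basic semantics -/

section Semantics

variable {W : Type u} {F : BiIntFrame W} {V : Valuation F}

theorem sat_mono {φ : Formula} {w v : W} (hw : Sat F V w φ) (h : F.le w v) : Sat F V v φ := by
  induction φ generalizing w v with
  | var p => exact V.monotone p w v hw h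
  | bot => exact F.fallible_le w v hw h
  | and a b iha ihb => exact ⟨iha hw.1 h, ihb hw.2 h⟩
  | or a b iha ihb => exact hw.imp (iha · h) (ihb · h)
  | imp a b => exact fun z hz => hw z (F.le_trans _ _ _ h hz)
  | dia a => exact fun z hz => hw z (F.le_trans _ _ _ h hz)
  | box a => exact fun z y hz => hw z y (F.le_trans _ _ _ h hz)

/-- Forth-up confluence makes the evaluation of `◇` local. -/
theorem sat_dia_iff (hup : F.ForthUpConfluent) {w : W} {φ : Formula} :
    Sat F V w (dia φ) ↔ ∃ v, F.acc w v ∧ Sat F V v φ := by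
  refine ⟨fun h => h w (F.le_refl w), fun ⟨v, hv, hφ⟩ z hz => ?_⟩
  obtain ⟨y, hy, hzy⟩ := hup _ _ _ hz hv
  exact ⟨y, hzy, sat_mono hφ hy⟩

/-- Forth-down confluence makes the evaluation of `□` local. -/
theorem sat_box_iff (hdown : F.ForthDownConfluent) {w : W} {φ : Formula} :
    Sat F V w (box φ) ↔ ∀ v, F.acc w v → Sat F V v φ := by
  refine ⟨fun h v hv => h w v (F.le_refl w) hv, fun h z y hz hy => ?_⟩
  obtain ⟨x, hx, hxy⟩ := hdown _ _ _ hz hy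
  exact sat_mono (h x hx) hxy

end Semantics

/-- The set of subformulas of a formula. -/
def Formula.subformulas : Formula → Set Formula
  | .var n => {.var n}
  | .bot => {.bot}
  | .and φ ψ => insert (.and φ ψ) (subformulas φ ∪ subformulas ψ)
  | .or φ ψ => insert (.or φ ψ) (subformulas φ ∪ subformulas ψ)
  | .imp φ ψ => insert (.imp φ ψ) (subformulas φ ∪ subformulas ψ)
  | .dia φ => insert (.dia φ) (subformulas φ)
  | .box φ => insert (.box φ) (subformulas φ)

/-- A set of formulas is closed if it contains the immediate constituents of its members. -/
structure SubClosed (S : Set Formula) : Prop where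
  and : ∀ φ ψ, Formula.and φ ψ ∈ S → φ ∈ S ∧ ψ ∈ S
  or : ∀ φ ψ, Formula.or φ ψ ∈ S → φ ∈ S ∧ ψ ∈ S
  imp : ∀ φ ψ, Formula.imp φ ψ ∈ S → φ ∈ S ∧ ψ ∈ S
  dia : ∀ φ, Formula.dia φ ∈ S → φ ∈ S
  box : ∀ φ, Formula.box φ ∈ S → φ ∈ S

theorem Formula.self_mem_subformulas (φ : Formula) : φ ∈ φ.subformulas := by
  cases φ <;> simp [subformulas]

theorem Formula.finite_subformulas (φ : Formula) : φ.subformulas.Finite := by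
  induction φ <;> simp_all [subformulas]

theorem Formula.subformulas_trans {φ ψ : Formula} (h : ψ ∈ φ.subformulas) :
    ψ.subformulas ⊆ φ.subformulas := by
  induction φ with
  | var | bot => obtain rfl := h; rfl
  | and a b iha ihb | or a b iha ihb | imp a b iha ihb =>
    rcases h with rfl | h | h
    · rfl
    · exact (iha h).trans (Set.subset_union_left.trans (Set.subset_insert _ _))
    · exact (ihb h).trans (Set.subset_union_right.trans (Set.subset_insert _ _))
  | dia a iha | box a iha =>
    rcases h with rfl | h
    · rfl
    · exact (iha h).trans (Set.subset_insert _ _)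

theorem Formula.subClosed_subformulas (φ : Formula) : SubClosed φ.subformulas := by
  constructor <;> intros <;> (try constructor) <;>
  · refine subformulas_trans ‹_› ?_
    simp [subformulas, self_mem_subformulas]

/-! ### The finite model -/

/-- One set of formulas may see another along the modal relation: boxed formulas are passed on,
and diamond formulas are passed back. -/
def Coherent (s t : Set Formula) : Prop :=
  ∀ ψ, (box ψ ∈ s → box ψ ∈ t) ∧ (dia ψ ∈ t → dia ψ ∈ s)

section PathModel

variable {W : Type u} {H : Type v} (F : BiIntFrame W) (lab : W → Set Formula) (U : W → H)

/-- A map of paths is a path map if it preserves extension and moves every path to a coherent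
one. -/
structure IsPathMap (f : {l // IsPath F.le lab U l} → {l // IsPath F.le lab U l}) : Prop where
  mono : ∀ s t, s.1 <:+ t.1 → (f s).1 <:+ (f t).1
  coherent : ∀ s, Coherent (pathLabel lab U s.1) (pathLabel lab U (f s).1)

/-- The frame of paths, ordered by extension; its modal relation holds from each path to its images
under path maps. -/
def pathFrame : BiIntFrame {l // IsPath F.le lab U l} where
  fallible := ∅
  le s t := s.1 <:+ t.1
  acc s t := ∃ f, IsPathMap F lab U f ∧ f s = t
  le_refl _ := List.suffix_rfl
  le_trans _ _ _ h h' := h.trans h'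
  acc_refl _ := ⟨id, ⟨fun _ _ h => h, fun _ _ => ⟨id, id⟩⟩, rfl⟩
  acc_trans := by
    rintro s _ _ ⟨f, hf, rfl⟩ ⟨g, hg, rfl⟩
    refine ⟨g ∘ f, ⟨fun s t h => hg.mono _ _ (hf.mono _ _ h), fun s ψ => ?_⟩, rfl⟩
    exact ⟨((hg.coherent (f s) ψ).1 ∘ (hf.coherent s ψ).1),
      ((hf.coherent s ψ).2 ∘ (hg.coherent (f s) ψ).2)⟩
  fallible_le _ _ h := h.elim
  fallible_acc _ _ h := h.elim

theorem pathFrame_mem_S4IFrames : S4IFrames _ (pathFrame F lab U) := by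
  refine ⟨?_, ?_, rfl⟩
  · rintro s s' _ hs ⟨f, hf, rfl⟩
    exact ⟨f s', hf.mono _ _ hs, f, hf, rfl⟩
  · rintro s t _ hs ⟨f, hf, rfl⟩
    exact ⟨f s, ⟨f, hf, rfl⟩, hf.mono _ _ hs⟩

variable {F lab U}

/-- Modal steps in the given frame are matched by path maps: lift the step along the tree of all
paths with the same root, and read off the shapes that are passed in the lifted tree. -/
theorem exists_pathMap (hup : F.ForthUpConfluent) (hdown : F.ForthDownConfluent)
    (hacc : ∀ w v, F.acc w v → Coherent (lab w) (lab v))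
    (hU : ∀ w w', U w = U w' → lab w = lab w' ∧
      ∀ v, F.le w v → lab v ≠ lab w → ∃ v', F.le w' v' ∧ lab v' ≠ lab w' ∧ U v' = U v)
    (p : {l // IsPath F.le lab U l}) :
    ∃ w, pathLabel lab U p.1 = lab w ∧ ∀ v, F.acc w v →
      ∃ q, (pathFrame F lab U).acc p q ∧ pathLabel lab U q.1 = lab v := by
  classical
  have hU' := fun w w' h => (hU w w' h).1
  obtain ⟨w₀, hw₀⟩ := p.2.2
  obtain ⟨g, hg, hgU⟩ := exists_realization F.le_refl hU w₀
  have hgl : ∀ s, IsPath F.le lab U s → s.getLast? = some (U w₀) →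
      pathLabel lab U s = lab (g s) := by
    intro s hs hsl
    have h1 := hgU s hs hsl
    obtain ⟨w, t, rfl⟩ := hs.exists_head
    simp only [List.head?_cons, Option.some.injEq] at h1
    rw [pathLabel_cons hU', hU' _ _ h1]
  refine ⟨g p.1, hgl p.1 p.2 hw₀, fun v hv => ?_⟩
  obtain ⟨y, hyp, hgy, hy⟩ := exists_lift hup hdown hg p.1 v hv
  have hspec := fun s => shapePath_spec (lab := lab) (U := U) F.le_refl F.le_trans hy s
  have hlab : ∀ s, pathLabel lab U (shapePath lab U y s) = lab (y s) := by
    intro s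
    obtain ⟨-, x, t, e, hx, -⟩ := hspec s
    rw [e, pathLabel_cons hU', hx]
  -- Paths with another root have no part in the step and stay fixed.
  let f : {l // IsPath F.le lab U l} → {l // IsPath F.le lab U l} := fun s =>
    if s.1.getLast? = some (U w₀) then ⟨shapePath lab U y s.1, (hspec s.1).1⟩ else s
  have hf : IsPathMap F lab U f := by
    constructor
    · intro s t hst
      have hlast : s.1.getLast? = t.1.getLast? := by
        obtain ⟨w, r, hr⟩ := s.2.exists_head
        obtain ⟨l, hl⟩ := hst
        rw [← hl, List.getLast?_append, hr]
        simp [List.getLast?_cons]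
      by_cases h : t.1.getLast? = some (U w₀)
      · simpa only [f, hlast, if_pos h] using shapePath_suffix y hst
      · simpa only [f, hlast, if_neg h] using hst
    · intro s
      by_cases h : s.1.getLast? = some (U w₀)
      · simp only [f, if_pos h]
        rw [hlab, hgl s.1 s.2 h]
        exact hacc _ _ (hgy _)
      · simp only [f, if_neg h]
        exact fun _ => ⟨id, id⟩
  refine ⟨f p, ⟨f, hf, rfl⟩, ?_⟩
  simp only [f, if_pos hw₀]
  rw [hlab, hyp]

end PathModel

/-- Every `S4I` model agrees with a finite `S4I` model on a given formula. -/
theorem exists_finite_model {W : Type u} {F : BiIntFrame W} (hF : S4IFrames W F)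
    (V : Valuation F) (φ : Formula) :
    ∃ (P : Type v) (_ : Finite P) (G : BiIntFrame P) (_ : S4IFrames P G) (V' : Valuation G),
      ∀ w, ∃ p, Sat G V' p φ ↔ Sat F V w φ := by
  obtain ⟨hup, hdown, hinf⟩ := hF
  have hS := φ.subClosed_subformulas
  set S := φ.subformulas
  let lab : W → Set Formula := fun w => {ψ | ψ ∈ S ∧ Sat F V w ψ}
  have hmono : ∀ w v, F.le w v → lab w ⊆ lab v := fun w v h ψ hψ => ⟨hψ.1, sat_mono hψ.2 h⟩
  have hacc : ∀ w v, F.acc w v → Coherent (lab w) (lab v) := by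
    refine fun w v h ψ => ⟨fun hψ => ⟨hψ.1, ?_⟩, fun hψ => ⟨hψ.1, ?_⟩⟩
    · rw [sat_box_iff hdown]
      exact fun z hz => (sat_box_iff hdown).1 hψ.2 z (F.acc_trans _ _ _ h hz)
    · obtain ⟨z, hz, hzψ⟩ := (sat_dia_iff hup).1 hψ.2
      exact (sat_dia_iff hup).2 ⟨z, F.acc_trans _ _ _ h hz, hzψ⟩
  obtain ⟨H, hH, U, hU⟩ :=
    exists_finite_shape.{u, v} φ.finite_subformulas F.le lab (fun w ψ hψ => hψ.1) hmono
  have hU' := fun w w' h => (hU w w' h).1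
  let P := {l // IsPath F.le lab U l}
  let G : BiIntFrame P := pathFrame F lab U
  have hG : S4IFrames P G := pathFrame_mem_S4IFrames F lab U
  let V' : Valuation G :=
    { val := fun q => {p | var q ∈ pathLabel lab U p.1}
      monotone := fun q s t hs h => pathLabel_mono hmono hU' t.2 s.2 h hs
      fallible_subset := fun _ _ h => h.elim }
  -- Every path carries the label of a point.
  have hrep : ∀ p : P, ∃ w t, p.1 = U w :: t ∧ pathLabel lab U p.1 = lab w := by
    intro p
    obtain ⟨w, t, h⟩ := p.2.exists_head
    exact ⟨w, t, h, by rw [h, pathLabel_cons hU']⟩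
  have truth : ∀ ψ ∈ S, ∀ p : P, Sat G V' p ψ ↔ ψ ∈ pathLabel lab U p.1 := by
    intro ψ
    induction ψ with
    | var q => exact fun _ _ => Iff.rfl
    | bot =>
      intro _ p
      obtain ⟨w, -, -, e⟩ := hrep p
      rw [e]
      refine ⟨fun h => h.elim, fun h => ?_⟩
      have : w ∈ F.fallible := h.2
      rw [hinf] at this
      exact this.elim
    | and a b iha ihb =>
      intro h p
      obtain ⟨ha, hb⟩ := hS.and _ _ h
      change _ ∧ _ ↔ _
      obtain ⟨w, -, -, e⟩ := hrep p
      rw [iha ha, ihb hb, e]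
      exact ⟨fun h' => ⟨h, h'.1.2, h'.2.2⟩, fun h' => ⟨⟨ha, h'.2.1⟩, hb, h'.2.2⟩⟩
    | or a b iha ihb =>
      intro h p
      obtain ⟨ha, hb⟩ := hS.or _ _ h
      change _ ∨ _ ↔ _
      obtain ⟨w, -, -, e⟩ := hrep p
      rw [iha ha, ihb hb, e]
      exact ⟨fun h' => ⟨h, h'.imp And.right And.right⟩,
        fun h' => h'.2.imp (fun x => ⟨ha, x⟩) fun x => ⟨hb, x⟩⟩
    | imp a b iha ihb =>
      intro h p
      obtain ⟨ha, hb⟩ := hS.imp _ _ h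
      constructor
      · intro hp
        obtain ⟨w, t, hpw, e⟩ := hrep p
        rw [e]
        refine ⟨h, fun v hv hva => ?_⟩
        -- If `v` has the label of `w`, the path `p` itself decides; otherwise `v` extends it.
        by_cases hl : lab v = lab w
        · have := hp p List.suffix_rfl
          rw [iha ha, ihb hb, e, ← hl] at this
          exact (this ⟨ha, hva⟩).2
        · have hq : IsPath F.le lab U (U v :: p.1) := by
            rw [hpw]
            exact IsPath.cons (hpw ▸ p.2) ⟨w, v, hv, hl, rfl, rfl⟩
          have := hp ⟨_, hq⟩ (List.suffix_cons _ _)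
          rw [iha ha, ihb hb, pathLabel_cons hU'] at this
          exact (this ⟨ha, hva⟩).2
      · intro hp q hpq hq
        have hp' := pathLabel_mono hmono hU' q.2 p.2 hpq hp
        rw [iha ha] at hq
        rw [ihb hb]
        obtain ⟨w, -, -, e⟩ := hrep q
        rw [e] at hp' hq ⊢
        exact ⟨hb, hp'.2 w (F.le_refl w) hq.2⟩
    | dia a iha =>
      intro h p
      have ha := hS.dia _ h
      rw [sat_dia_iff hG.1]
      constructor
      · rintro ⟨_, ⟨f, hf, rfl⟩, hq⟩
        rw [iha ha] at hq
        refine (hf.coherent p a).2 ?_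
        obtain ⟨w, -, -, e⟩ := hrep (f p)
        rw [e] at hq ⊢
        exact ⟨h, (sat_dia_iff hup).2 ⟨w, F.acc_refl w, hq.2⟩⟩
      · intro hp
        obtain ⟨w, hw, hstep⟩ := exists_pathMap hup hdown hacc hU p
        rw [hw] at hp
        obtain ⟨v, hv, hva⟩ := (sat_dia_iff hup).1 hp.2
        obtain ⟨q, hq, hqv⟩ := hstep v hv
        refine ⟨q, hq, (iha ha q).2 ?_⟩
        rw [hqv]
        exact ⟨ha, hva⟩
    | box a iha =>
      intro h p
      have ha := hS.box _ h
      rw [sat_box_iff hG.2.1]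
      constructor
      · intro hp
        obtain ⟨w, hw, hstep⟩ := exists_pathMap hup hdown hacc hU p
        rw [hw]
        refine ⟨h, (sat_box_iff hdown).2 fun v hv => ?_⟩
        obtain ⟨q, hq, hqv⟩ := hstep v hv
        have := (iha ha q).1 (hp q hq)
        rw [hqv] at this
        exact this.2
      · rintro hp _ ⟨f, hf, rfl⟩
        rw [iha ha]
        have := (hf.coherent p a).1 hp
        obtain ⟨w, -, -, e⟩ := hrep (f p)
        rw [e] at this ⊢
        exact ⟨ha, (sat_box_iff hdown).1 this.2 w (F.acc_refl w)⟩
  refine ⟨P, finite_paths hmono hU', G, hG, V', fun w => ⟨⟨[U w], isPath_singleton w⟩, ?_⟩⟩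
  rw [truth φ φ.self_mem_subformulas, pathLabel_cons hU']
  exact ⟨fun h => h.2, fun h => ⟨φ.self_mem_subformulas, h⟩⟩

theorem falsifiable_finite {φ : Formula} (h : Falsifiable S4IFrames.{u} φ) :
    Falsifiable FiniteS4IFrames.{v} φ := by
  intro hval
  refine h fun W F hF V w _ _ => ?_
  obtain ⟨P, hP, G, hG, V', hag⟩ := exists_finite_model.{u, v} hF V φ
  obtain ⟨p, hp⟩ := hag w
  refine hp.1 (hval P G ⟨hP, hG⟩ V' p ?_ (by simp))
  rw [hG.2.2]
  exact id

theorem satisfiable_finite {φ : Formula} (h : Satisfiable S4IFrames.{u} φ) :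
    Satisfiable FiniteS4IFrames.{v} φ := by
  intro hcon
  refine h fun W F hF V w _ hw => ?_
  obtain ⟨P, hP, G, hG, V', hag⟩ := exists_finite_model.{u, v} hF V φ
  obtain ⟨p, hp⟩ := hag w
  have hpf : p ∉ G.fallible := by rw [hG.2.2]; exact id
  refine (hpf (hcon P G ⟨hP, hG⟩ V' p hpf ?_)).elim
  rintro _ rfl
  exact hp.2 (hw _ rfl)

/-! ### Soundness -/

theorem S4IDerivable.sound {φ : Formula} (h : S4IDerivable φ) {W : Type u} {F : BiIntFrame W}
    (hF : S4IFrames W F) (V : Valuation F) (w : W) : Sat F V w φ := by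
  obtain ⟨hup, hdown, hinf⟩ := hF
  have hbot : ∀ {z}, ¬ Sat F V z bot := fun {z} (h : z ∈ F.fallible) => by
    rw [hinf] at h; exact h
  have imp_intro : ∀ {w a b}, (∀ z, Sat F V z a → Sat F V z b) → Sat F V w (imp a b) :=
    fun h z _ hz => h z hz
  have mp : ∀ {w a b}, Sat F V w (imp a b) → Sat F V w a → Sat F V w b :=
    fun {w _ _} h ha => h w (F.le_refl w) ha
  induction h generalizing w with
  | int h =>
    cases h with
    | k a b => exact imp_intro fun z hz y hy _ => sat_mono hz hy
    | s a b c =>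
      exact imp_intro fun z hz y hy hab x hx ha => mp (hz x (F.le_trans _ _ _ hy hx) ha) (hab x hx ha)
    | andIntro a b => exact imp_intro fun z hz y hy hb => ⟨sat_mono hz hy, hb⟩
    | andLeft a b => exact imp_intro fun z hz => hz.1
    | andRight a b => exact imp_intro fun z hz => hz.2
    | orLeft a b => exact imp_intro fun z hz => Or.inl hz
    | orRight a b => exact imp_intro fun z hz => Or.inr hz
    | orElim a b c =>
      exact imp_intro fun z hz y hy hb x hx hab =>
        hab.elim (hz x (F.le_trans _ _ _ hy hx)) (hb x hx)
    | exFalso a => exact imp_intro fun z hz => (hbot hz).elim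
  | cs4 h =>
    cases h with
    | kBox a b =>
      exact imp_intro fun z hz y hy ha x t hx ht =>
        mp (hz x t (F.le_trans _ _ _ hy hx) ht) (ha x t hx ht)
    | kDia a b =>
      refine imp_intro fun z hz y hy ha x hx => ?_
      obtain ⟨t, ht, hta⟩ := ha x hx
      exact ⟨t, ht, mp (hz x t (F.le_trans _ _ _ hy hx) ht) hta⟩
    | tBox a => exact imp_intro fun z hz => hz z z (F.le_refl z) (F.acc_refl z)
    | tDia a => exact imp_intro fun z hz y hy => ⟨y, F.acc_refl y, sat_mono hz hy⟩
    | fourBox a =>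
      refine imp_intro fun z hz => ?_
      rw [sat_box_iff hdown] at hz ⊢
      intro y hy
      rw [sat_box_iff hdown]
      exact fun x hx => hz x (F.acc_trans _ _ _ hy hx)
    | fourDia a =>
      refine imp_intro fun z hz => ?_
      rw [sat_dia_iff hup] at hz ⊢
      obtain ⟨y, hy, hya⟩ := hz
      obtain ⟨x, hx, hxa⟩ := (sat_dia_iff hup).1 hya
      exact ⟨x, F.acc_trans _ _ _ hy hx, hxa⟩
  | s4i h =>
    cases h with
    | dp a b =>
      refine imp_intro fun z hz => ?_
      obtain ⟨y, hy, hab⟩ := (sat_dia_iff hup).1 hz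
      exact hab.imp (fun h => (sat_dia_iff hup).2 ⟨y, hy, h⟩)
        (fun h => (sat_dia_iff hup).2 ⟨y, hy, h⟩)
    | n =>
      refine imp_intro fun z hz => ?_
      obtain ⟨y, -, hyb⟩ := (sat_dia_iff hup).1 hz
      exact (hbot hyb).elim
    | cd a b =>
      refine imp_intro fun z hz => ?_
      rw [sat_box_iff hdown] at hz
      refine or_iff_not_imp_right.2 fun hb => (sat_box_iff hdown).2 fun y hy => ?_
      exact (hz y hy).resolve_right fun h => hb ((sat_dia_iff hup).2 ⟨y, hy, h⟩)
  | mp _ _ ih₁ ih₂ => exact mp (ih₁ w) (ih₂ w)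
  | nec _ ih => exact fun _ y _ _ => ih y

/-! ### Prime theories -/

/-- A theory contains all derivable formulas and is closed under modus ponens. -/
structure IsTheory (T : Set Formula) : Prop where
  der : ∀ {φ}, S4IDerivable φ → φ ∈ T
  mp : ∀ {φ ψ}, imp φ ψ ∈ T → φ ∈ T → ψ ∈ T

/-- A prime theory is a consistent theory with the disjunction property. -/
structure IsPrime (T : Set Formula) : Prop extends IsTheory T where
  bot_notMem : bot ∉ T
  or_mem : ∀ {φ ψ}, Formula.or φ ψ ∈ T → φ ∈ T ∨ ψ ∈ T

namespace IsTheory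

variable {T : Set Formula} (hT : IsTheory T) {a b c : Formula}
include hT

theorem k (h : b ∈ T) : imp a b ∈ T := hT.mp (hT.der (.int (.k _ _))) h

theorem s (h : imp a (imp b c) ∈ T) (h' : imp a b ∈ T) : imp a c ∈ T :=
  hT.mp (hT.mp (hT.der (.int (.s _ _ _))) h) h'

theorem imp_self (a : Formula) : imp a a ∈ T :=
  hT.s (b := imp a a) (hT.der (.int (.k _ _))) (hT.der (.int (.k _ _)))

theorem imp_trans (h : imp a b ∈ T) (h' : imp b c ∈ T) : imp a c ∈ T := hT.s (hT.k h') h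

theorem and_mem (ha : a ∈ T) (hb : b ∈ T) : and a b ∈ T :=
  hT.mp (hT.mp (hT.der (.int (.andIntro _ _))) ha) hb

theorem imp_or_left (h : imp a b ∈ T) : imp a (or b c) ∈ T :=
  hT.imp_trans h (hT.der (.int (.orLeft _ _)))

theorem imp_or_right (h : imp a c ∈ T) : imp a (or b c) ∈ T :=
  hT.imp_trans h (hT.der (.int (.orRight _ _)))

theorem or_imp (h : imp a c ∈ T) (h' : imp b c ∈ T) : imp (or a b) c ∈ T :=
  hT.mp (hT.mp (hT.der (.int (.orElim _ _ _))) h) h'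

theorem exFalso (a : Formula) : imp bot a ∈ T := hT.der (.int (.exFalso _))

theorem box_mp (h : box (imp a b) ∈ T) (h' : box a ∈ T) : box b ∈ T :=
  hT.mp (hT.mp (hT.der (.cs4 (.kBox _ _))) h) h'

theorem dia_mp (h : box (imp a b) ∈ T) (h' : dia a ∈ T) : dia b ∈ T :=
  hT.mp (hT.mp (hT.der (.cs4 (.kDia _ _))) h) h'

/-- The formulas implied by `a` over `T` form the theory generated by `T` and `a`. -/
theorem adjoin (a : Formula) : IsTheory {b | imp a b ∈ T} where
  der h := hT.k (hT.der h)
  mp h h' := hT.s h h'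

/-- The formulas that are necessary over `T` form a theory. -/
theorem unbox : IsTheory {b | box b ∈ T} where
  der h := hT.der (.nec h)
  mp h h' := hT.box_mp h h'

end IsTheory

theorem isTheory_S4I : IsTheory S4I := ⟨id, .mp⟩

/-- Prime theories separate a theory from any disjoint set of formulas that contains falsum and is
closed under disjunction: a maximal theory disjoint from that set is prime. -/
theorem exists_prime {T D : Set Formula} (hT : IsTheory T) (hbot : bot ∈ D)
    (hor : ∀ a ∈ D, ∀ b ∈ D, or a b ∈ D) (hdisj : ∀ a ∈ T, a ∉ D) :
    ∃ P, IsPrime P ∧ T ⊆ P ∧ ∀ a ∈ P, a ∉ D := by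
  obtain ⟨P, hTP, hP⟩ := zorn_subset_nonempty {P | IsTheory P ∧ ∀ a ∈ P, a ∉ D} (by
    intro C hC hchain ⟨Q, hQ⟩
    refine ⟨⋃₀ C, ⟨⟨fun h => ⟨Q, hQ, (hC hQ).1.der h⟩, ?_⟩, ?_⟩, fun _ => Set.subset_sUnion_of_mem⟩
    · rintro a b ⟨X, hX, hab⟩ ⟨Y, hY, ha⟩
      rcases hchain.total hX hY with h | h
      · exact ⟨Y, hY, (hC hY).1.mp (h hab) ha⟩
      · exact ⟨X, hX, (hC hX).1.mp hab (h ha)⟩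
    · rintro a ⟨X, hX, ha⟩
      exact (hC hX).2 a ha) T ⟨hT, hdisj⟩
  obtain ⟨hPth, hPD⟩ := hP.prop
  have key : ∀ a, a ∉ P → ∃ d ∈ D, imp a d ∈ P := by
    intro a ha
    by_contra! hcon
    refine ha (hP.le_of_ge (y := {b | imp a b ∈ P})
      ⟨hPth.adjoin a, fun b hb hbD => hcon b hbD hb⟩ (fun b hb => hPth.k hb) (hPth.imp_self a))
  refine ⟨P, ⟨hPth, fun h => hPD _ h hbot, fun {a b} hab => ?_⟩, hTP, hPD⟩
  by_contra! hcon
  obtain ⟨d, hd, had⟩ := key a hcon.1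
  obtain ⟨e, he, hbe⟩ := key b hcon.2
  exact hPD _ (hPth.mp (hPth.or_imp (hPth.imp_or_left had) (hPth.imp_or_right hbe)) hab)
    (hor d hd e he)

/-- A theory that does not prove `a` extends to a prime theory without `a`. -/
theorem exists_prime_notMem {T : Set Formula} (hT : IsTheory T) {a : Formula} (ha : a ∉ T) :
    ∃ P, IsPrime P ∧ T ⊆ P ∧ a ∉ P := by
  obtain ⟨P, hP, hTP, hd⟩ := exists_prime (D := {b | imp b a ∈ T}) hT (hT.exFalso a)
    (fun b hb c hc => hT.or_imp hb hc) fun b hb h => ha (hT.mp h hb)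
  exact ⟨P, hP, hTP, fun h => hd a h (hT.imp_self a)⟩

/-! ### Completeness -/

/-- The modal relation between prime theories: what is necessary in the first holds in the second,
and what holds in the second is possible in the first. -/
def PrimeAcc (T T' : Set Formula) : Prop :=
  (∀ a, box a ∈ T → a ∈ T') ∧ ∀ a, a ∈ T' → dia a ∈ T

/-- If all formulas of the theory `G` are possible in `P` and `G` contains what is necessary in
`P`, then `G` extends to a prime theory accessible from `P`. -/
theorem IsPrime.exists_acc_above {P G : Set Formula} (hP : IsPrime P) (hG : IsTheory G)
    (hbox : ∀ a, box a ∈ P → a ∈ G) (hdia : ∀ a ∈ G, dia a ∈ P) :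
    ∃ Q, IsPrime Q ∧ PrimeAcc P Q ∧ G ⊆ Q := by
  obtain ⟨Q, hQ, hGQ, hd⟩ := exists_prime (D := {a | dia a ∉ P}) hG
    (fun h => hP.bot_notMem (hP.mp (hP.der (.s4i .n)) h))
    (fun a ha b hb h => (hP.or_mem (hP.mp (hP.der (.s4i (.dp _ _))) h)).elim ha hb)
    fun a ha h => h (hdia a ha)
  exact ⟨Q, hQ, ⟨fun a ha => hGQ (hbox a ha), fun a ha => not_not.1 (hd a ha)⟩, hGQ⟩

/-- If no formula of a `∨`-closed set `I` is necessary in `P`, then some prime theory accessible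
from `P` is disjoint from `I`. This is where the axiom `CD` is needed. -/
theorem IsPrime.exists_acc_disjoint {P I : Set Formula} (hP : IsPrime P) (hbot : bot ∈ I)
    (hor : ∀ a ∈ I, ∀ b ∈ I, or a b ∈ I) (hbox : ∀ a ∈ I, box a ∉ P) :
    ∃ Q, IsPrime Q ∧ PrimeAcc P Q ∧ ∀ a ∈ Q, a ∉ I := by
  have hth := isTheory_S4I
  have hdbot : dia bot ∉ P := fun h => hP.bot_notMem (hP.mp (hP.der (.s4i .n)) h)
  obtain ⟨Q, hQ, hPQ, hd⟩ := exists_prime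
    (D := {a | ∃ b ∈ I, ∃ c, dia c ∉ P ∧ imp a (or b c) ∈ S4I}) hP.toIsTheory.unbox
    ⟨bot, hbot, bot, hdbot, hth.exFalso _⟩ (by
      rintro a ⟨b, hb, c, hc, h⟩ a' ⟨b', hb', c', hc', h'⟩
      refine ⟨or b b', hor b hb b' hb', or c c', fun hcc => ?_, ?_⟩
      · exact (hP.or_mem (hP.mp (hP.der (.s4i (.dp _ _))) hcc)).elim hc hc'
      · refine hth.or_imp (hth.imp_trans h ?_) (hth.imp_trans h' ?_)
        · exact hth.or_imp (hth.imp_or_left (hth.imp_or_left (hth.imp_self _)))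
            (hth.imp_or_right (hth.imp_or_left (hth.imp_self _)))
        · exact hth.or_imp (hth.imp_or_left (hth.imp_or_right (hth.imp_self _)))
            (hth.imp_or_right (hth.imp_or_right (hth.imp_self _)))) (by
      rintro a ha ⟨b, hb, c, hc, h⟩
      have : box (or b c) ∈ P := hP.toIsTheory.box_mp (hP.der (.nec h)) ha
      exact (hP.or_mem (hP.mp (hP.der (.s4i (.cd _ _))) this)).elim (hbox b hb) hc)
  refine ⟨Q, hQ, ⟨fun a ha => hPQ ha, fun a ha => ?_⟩, fun a ha haI => ?_⟩
  · by_contra hda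
    exact hd a ha ⟨bot, hbot, a, hda, hth.imp_or_right (hth.imp_self _)⟩
  · exact hd a ha ⟨a, haI, bot, hdbot, hth.imp_or_left (hth.imp_self _)⟩

/-- The frame of prime theories, ordered by inclusion. -/
def canonicalFrame : BiIntFrame {T // IsPrime T} where
  fallible := ∅
  le T T' := T.1 ⊆ T'.1
  acc T T' := PrimeAcc T.1 T'.1
  le_refl _ := subset_rfl
  le_trans _ _ _ h h' := h.trans h'
  acc_refl T := ⟨fun _ h => T.2.mp (T.2.der (.cs4 (.tBox _))) h,
    fun _ h => T.2.mp (T.2.der (.cs4 (.tDia _))) h⟩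
  acc_trans T _ _ h h' := ⟨fun a ha => h'.1 a (h.1 _ (T.2.mp (T.2.der (.cs4 (.fourBox _))) ha)),
    fun a ha => T.2.mp (T.2.der (.cs4 (.fourDia _))) (h.2 _ (h'.2 a ha))⟩
  fallible_le _ _ h := h.elim
  fallible_acc _ _ h := h.elim

theorem canonicalFrame_mem_S4IFrames : S4IFrames _ canonicalFrame := by
  refine ⟨?_, ?_, rfl⟩
  · rintro ⟨P, hP⟩ ⟨P', hP'⟩ ⟨Q, hQ⟩ (hPP : P ⊆ P') (hPQ : PrimeAcc P Q)
    obtain ⟨Q', hQ', hacc, hsub⟩ := hP'.exists_acc_above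
      (G := {c | ∃ b ∈ Q, box (imp b c) ∈ P'}) (by
        refine ⟨fun {a} ha => ⟨a, hQ.der ha, ?_⟩, ?_⟩
        · exact hP'.der (.nec (isTheory_S4I.imp_self _))
        · rintro a b ⟨c, hc, h⟩ ⟨d, hd, h'⟩
          have hU := hP'.toIsTheory.unbox
          refine ⟨and c d, hQ.toIsTheory.and_mem hc hd, ?_⟩
          exact hU.s (hU.imp_trans (hU.der (.int (.andLeft _ _))) h)
            (hU.imp_trans (hU.der (.int (.andRight _ _))) h'))
      (fun a ha => ⟨imp a a, hQ.toIsTheory.imp_self a, hP'.toIsTheory.unbox.k ha⟩)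
      (fun a ⟨b, hb, h⟩ => hP'.toIsTheory.dia_mp h (hPP (hPQ.2 b hb)))
    exact ⟨⟨Q', hQ'⟩, fun b hb => hsub ⟨b, hb, hP'.toIsTheory.unbox.imp_self b⟩, hacc⟩
  · rintro ⟨P, hP⟩ ⟨Q, hQ⟩ ⟨Q', hQ'⟩ (hPQ : P ⊆ Q) (hacc : PrimeAcc Q Q')
    obtain ⟨P', hP', hacc', hd⟩ := hP.exists_acc_disjoint (I := {a | a ∉ Q'}) hQ'.bot_notMem
      (fun a ha b hb h => (hQ'.or_mem h).elim ha hb) fun a ha h => ha (hacc.1 a (hPQ h))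
    exact ⟨⟨P', hP'⟩, hacc', fun a ha => not_not.1 (hd a ha)⟩

/-- In the canonical frame, every variable holds in the prime theories that contain it. -/
def canonicalValuation : Valuation canonicalFrame where
  val q := {T | var q ∈ T.1}
  monotone _ _ _ h h' := h' h
  fallible_subset _ _ h := h.elim

theorem sat_canonical_iff (φ : Formula) (T : {T // IsPrime T}) :
    Sat canonicalFrame canonicalValuation T φ ↔ φ ∈ T.1 := by
  have hup := canonicalFrame_mem_S4IFrames.1
  have hdown := canonicalFrame_mem_S4IFrames.2.1
  induction φ generalizing T with
  | var q => exact Iff.rfl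
  | bot => exact ⟨fun h => h.elim, fun h => (T.2.bot_notMem h).elim⟩
  | and a b iha ihb =>
    refine (and_congr (iha T) (ihb T)).trans ⟨fun h => T.2.toIsTheory.and_mem h.1 h.2, fun h =>
      ⟨T.2.mp (T.2.der (.int (.andLeft _ _))) h, T.2.mp (T.2.der (.int (.andRight _ _))) h⟩⟩
  | or a b iha ihb =>
    refine (or_congr (iha T) (ihb T)).trans ⟨fun h => h.elim (T.2.mp (T.2.der (.int (.orLeft _ _))))
      (T.2.mp (T.2.der (.int (.orRight _ _)))), T.2.or_mem⟩
  | imp a b iha ihb =>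
    constructor
    · intro h
      by_contra hcon
      obtain ⟨P, hP, hsub, hb⟩ := exists_prime_notMem (T.2.toIsTheory.adjoin a) hcon
      refine hb ((ihb ⟨P, hP⟩).1 (h ⟨P, hP⟩ (fun c hc => hsub (T.2.toIsTheory.k hc)) ?_))
      exact (iha ⟨P, hP⟩).2 (hsub (T.2.toIsTheory.imp_self a))
    · intro h T' hT' ha
      exact (ihb T').2 (T'.2.mp (hT' h) ((iha T').1 ha))
  | dia a iha =>
    rw [sat_dia_iff hup]
    constructor
    · rintro ⟨T', hT', ha⟩
      exact hT'.2 a ((iha T').1 ha)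
    · intro h
      obtain ⟨Q, hQ, hacc, hsub⟩ := T.2.exists_acc_above (T.2.toIsTheory.unbox.adjoin a)
        (fun b hb => T.2.toIsTheory.unbox.k hb) fun b hb => T.2.toIsTheory.dia_mp hb h
      exact ⟨⟨Q, hQ⟩, hacc, (iha ⟨Q, hQ⟩).2 (hsub (T.2.toIsTheory.unbox.imp_self a))⟩
  | box a iha =>
    rw [sat_box_iff hdown]
    constructor
    · intro h
      by_contra hcon
      have hU := T.2.toIsTheory.unbox
      obtain ⟨Q, hQ, hacc, hd⟩ := T.2.exists_acc_disjoint (I := {b | imp b a ∈ {b | box b ∈ T.1}})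
        (hU.exFalso a) (fun b hb c hc => hU.or_imp hb hc) fun b hb h => hcon (hU.mp hb h)
      exact hd a ((iha ⟨Q, hQ⟩).1 (h ⟨Q, hQ⟩ hacc)) (hU.imp_self a)
    · intro h T' hT'
      exact (iha T').2 (hT'.1 a h)

/-- A formula is derivable in `S4I` exactly if it holds in all finite `S4I` models. -/
theorem mem_S4I_iff {φ : Formula} : φ ∈ S4I ↔ Valid FiniteS4IFrames.{0} φ := by
  refine ⟨fun h W F hF V w _ _ => S4IDerivable.sound h hF.2 V w, fun h => ?_⟩
  by_contra hφ
  refine falsifiable_finite.{0, 0} (fun hval => ?_) h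
  obtain ⟨P, hP, -, hn⟩ := exists_prime_notMem isTheory_S4I hφ
  exact hn ((sat_canonical_iff φ ⟨P, hP⟩).1
    (hval _ _ canonicalFrame_mem_S4IFrames _ ⟨P, hP⟩ id (by simp)))

/-! ### Primitive recursive and recursively enumerable predicates -/

section Primrec

variable {α β : Type} [Primcodable α] [Primcodable β]

theorem primrecPred_eq {f g : α → β} (hf : Primrec f) (hg : Primrec g) :
    PrimrecPred fun a => f a = g a := by
  classical exact Primrec.eq.comp hf hg

theorem primrecPred_imp {p q : α → Prop} (hp : PrimrecPred p) (hq : PrimrecPred q) :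
    PrimrecPred fun a => p a → q a :=
  (hp.not.or hq).of_eq fun _ => imp_iff_not_or.symm

theorem primrecPred_iff {p q : α → Prop} (hp : PrimrecPred p) (hq : PrimrecPred q) :
    PrimrecPred fun a => p a ↔ q a :=
  ((primrecPred_imp hp hq).and (primrecPred_imp hq hp)).of_eq fun _ => iff_def.symm

theorem primrecPred_lt {f g : α → ℕ} (hf : Primrec f) (hg : Primrec g) :
    PrimrecPred fun a => f a < g a :=
  Primrec.nat_lt.comp hf hg

theorem primrecPred_ball {l : α → List β} {p : α → β → Prop} (hl : Primrec l)
    (hp : PrimrecPred fun x : α × β => p x.1 x.2) : PrimrecPred fun a => ∀ b ∈ l a, p a b :=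
  (PrimrecRel.forall_mem_list (R := fun b a => p a b)
    (hp.comp (Primrec.snd.pair Primrec.fst))).comp hl Primrec.id

theorem primrecPred_bex {l : α → List β} {p : α → β → Prop} (hl : Primrec l)
    (hp : PrimrecPred fun x : α × β => p x.1 x.2) : PrimrecPred fun a => ∃ b ∈ l a, p a b :=
  (PrimrecRel.exists_mem_list (R := fun b a => p a b)
    (hp.comp (Primrec.snd.pair Primrec.fst))).comp hl Primrec.id

theorem primrecPred_mem {f : α → β} {l : α → List β} (hf : Primrec f) (hl : Primrec l) :
    PrimrecPred fun a => f a ∈ l a :=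
  (primrecPred_bex (p := fun a b => b = f a) hl
    (primrecPred_eq Primrec.snd (hf.comp Primrec.fst))).of_eq fun a => by simp

theorem primrec_id : Primrec fun a : α => a := Primrec.id

theorem primrec_fst {γ : Type} [Primcodable γ] {f : α → β × γ} (hf : Primrec f) :
    Primrec fun a => (f a).1 :=
  Primrec.fst.comp hf

theorem primrec_snd {γ : Type} [Primcodable γ] {f : α → β × γ} (hf : Primrec f) :
    Primrec fun a => (f a).2 :=
  Primrec.snd.comp hf

/-- A primitive recursive predicate becomes recursively enumerable after quantifying one argument
existentially. -/
theorem rePred_exists {p : α → β → Prop} (hp : PrimrecPred fun x : α × β => p x.1 x.2) :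
    REPred fun a => ∃ b, p a b := by
  classical
  have h : Primrec₂ fun (a : α) (n : ℕ) =>
      (Encodable.decode (α := β) n).bind fun b => if p a b then some () else none := by
    refine Primrec.option_bind (Primrec.decode.comp Primrec.snd) ?_
    exact Primrec.ite (hp.comp ((Primrec.fst.comp Primrec.fst).pair Primrec.snd))
      (Primrec.const _) (Primrec.const _)
  refine (Partrec.rfindOpt h.to_comp).dom_re.of_eq fun a => ?_
  rw [Nat.rfindOpt_dom]
  constructor
  · rintro ⟨n, _, h⟩
    obtain ⟨b, -, hb⟩ := Option.bind_eq_some_iff.1 h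
    by_contra! hcon
    simp [hcon b] at hb
  · rintro ⟨b, hb⟩
    exact ⟨Encodable.encode b, (), by simp [hb]⟩

end Primrec

/-! ### The primitive recursive coding of formulas -/

theorem pair_mem_range_code {t r : ℕ} : Nat.pair t r ∈ Set.range code ↔
    t = 0 ∨ (t = 1 ∧ r = 0) ∨ ((t = 2 ∨ t = 3 ∨ t = 4) ∧ r.unpair.1 ∈ Set.range code ∧
      r.unpair.2 ∈ Set.range code) ∨ ((t = 5 ∨ t = 6) ∧ r ∈ Set.range code) := by
  constructor
  · rintro ⟨φ, h⟩
    cases φ <;> simp only [code, Nat.pair_eq_pair] at h <;> obtain ⟨rfl, rfl⟩ := h <;> simp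
  · rintro (rfl | ⟨rfl, rfl⟩ | ⟨h, ⟨a, ha⟩, b, hb⟩ | ⟨h, a, rfl⟩)
    · exact ⟨var r, rfl⟩
    · exact ⟨bot, rfl⟩
    · rcases h with rfl | rfl | rfl
      · exact ⟨.and a b, by simp [code, ha, hb]⟩
      · exact ⟨.or a b, by simp [code, ha, hb]⟩
      · exact ⟨imp a b, by simp [code, ha, hb]⟩
    · rcases h with rfl | rfl
      · exact ⟨dia a, rfl⟩
      · exact ⟨box a, rfl⟩

/-- Being the code of a formula is decided by recursion on the code. -/
theorem primrecPred_mem_range_code : PrimrecPred fun n => n ∈ Set.range code := by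
  classical
  let test : ℕ → List Bool → ℕ → Prop := fun t l r =>
    t = 0 ∨ (t = 1 ∧ r = 0) ∨ ((t = 2 ∨ t = 3 ∨ t = 4) ∧ l.getD r.unpair.1 false = true ∧
      l.getD r.unpair.2 false = true) ∨ ((t = 5 ∨ t = 6) ∧ l.getD r false = true)
  let g : Unit → List Bool → Option Bool := fun _ l =>
    some (decide (test l.length.unpair.1 l l.length.unpair.2))
  have hg : Primrec₂ g := by
    have hl : Primrec fun x : Unit × List Bool => x.2.length := Primrec.list_length.comp Primrec.snd
    have ht := Primrec.fst.comp (Primrec.unpair.comp hl)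
    have hr := Primrec.snd.comp (Primrec.unpair.comp hl)
    have hd : ∀ {i : Unit × List Bool → ℕ}, Primrec i →
        PrimrecPred fun x : Unit × List Bool => x.2.getD (i x) false = true := fun hi =>
      primrecPred_eq ((Primrec.list_getD false).comp Primrec.snd hi) (Primrec.const _)
    have hc : ∀ k : ℕ, PrimrecPred fun x : Unit × List Bool => x.2.length.unpair.1 = k :=
      fun k => primrecPred_eq ht (Primrec.const k)
    refine Primrec.option_some.comp (PrimrecPred.decide ?_)
    refine (hc 0).or (((hc 1).and (primrecPred_eq hr (Primrec.const 0))).or (.or (.and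
      ((hc 2).or ((hc 3).or (hc 4))) (.and (hd ?_) (hd ?_))) (((hc 5).or (hc 6)).and (hd hr))))
    · exact Primrec.fst.comp (Primrec.unpair.comp hr)
    · exact Primrec.snd.comp (Primrec.unpair.comp hr)
  have key : Primrec₂ fun (_ : Unit) n => decide (n ∈ Set.range code) := by
    refine Primrec.nat_strong_rec _ hg fun _ n => ?_
    have hd : ∀ i < n, ((List.range n).map fun m => decide (m ∈ Set.range code)).getD i false
        = decide (i ∈ Set.range code) := by
      intro i hi
      simp [List.getD, hi]
    simp only [g, List.length_map, List.length_range, Option.some.injEq, decide_eq_decide]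
    obtain ⟨t, r, rfl⟩ : ∃ t r, n = Nat.pair t r := ⟨_, _, (Nat.pair_unpair n).symm⟩
    rw [pair_mem_range_code]
    simp only [Nat.unpair_pair, test]
    -- Only for the tags of compound formulas must the rest be smaller than the code.
    have hlt : 2 ≤ t → r < Nat.pair t r := fun h => by
      have := Nat.add_le_pair t r
      omega
    refine or_congr Iff.rfl (or_congr Iff.rfl (or_congr (and_congr_right fun h => ?_)
      (and_congr_right fun h => ?_)))
    · have hr := hlt (by omega)
      rw [hd _ ((Nat.unpair_left_le r).trans_lt hr), hd _ ((Nat.unpair_right_le r).trans_lt hr)]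
      simp
    · rw [hd _ (hlt (by omega))]
      simp
  exact PrimrecPred.of_eq (p := fun n => n ∈ Set.range code)
    (Primrec.primrecPred (key.comp (Primrec.const ()) Primrec.id)) fun _ => Iff.rfl

/-- Formulas are coded by the numbers in the range of `code`. -/
noncomputable instance : Primcodable Formula :=
  open Classical in
  letI : Primcodable {n // n ∈ Set.range code} := Primcodable.subtype primrecPred_mem_range_code
  Primcodable.ofEquiv {n // n ∈ Set.range code} (Equiv.ofInjective code code_injective)

/-- The encoding provided by the `Primcodable` instance is `code`. -/
theorem encode_formula (φ : Formula) : Encodable.encode φ = code φ := rfl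

section

variable {α : Type} [Primcodable α] {f g : α → Formula}

theorem primrec_code_iff : (Primrec fun a => code (f a)) ↔ Primrec f := by
  simpa only [encode_formula] using Primrec.encode_iff (f := f)

theorem primrec_tagged {c : Formula → Formula} {t : ℕ} (hc : ∀ φ, code (c φ) = Nat.pair t (code φ))
    (hf : Primrec f) : Primrec fun a => c (f a) :=
  primrec_code_iff.1 <| (Primrec₂.natPair.comp (Primrec.const t) (primrec_code_iff.2 hf)).of_eq
    fun _ => (hc _).symm

theorem primrec_tagged₂ {c : Formula → Formula → Formula} {t : ℕ}
    (hc : ∀ φ ψ, code (c φ ψ) = Nat.pair t (Nat.pair (code φ) (code ψ)))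
    (hf : Primrec f) (hg : Primrec g) : Primrec fun a => c (f a) (g a) :=
  primrec_code_iff.1 <| (Primrec₂.natPair.comp (Primrec.const t) (Primrec₂.natPair.comp
    (primrec_code_iff.2 hf) (primrec_code_iff.2 hg))).of_eq fun _ => (hc _ _).symm

theorem primrec_var {k : α → ℕ} (hk : Primrec k) : Primrec fun a => var (k a) :=
  primrec_code_iff.1 (Primrec₂.natPair.comp (Primrec.const 0) hk)

theorem primrec_and (hf : Primrec f) (hg : Primrec g) : Primrec fun a => Formula.and (f a) (g a) :=
  primrec_tagged₂ (fun _ _ => rfl) hf hg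

theorem primrec_or (hf : Primrec f) (hg : Primrec g) : Primrec fun a => Formula.or (f a) (g a) :=
  primrec_tagged₂ (fun _ _ => rfl) hf hg

theorem primrec_imp (hf : Primrec f) (hg : Primrec g) : Primrec fun a => imp (f a) (g a) :=
  primrec_tagged₂ (fun _ _ => rfl) hf hg

theorem primrec_dia (hf : Primrec f) : Primrec fun a => dia (f a) :=
  primrec_tagged (fun _ => rfl) hf

theorem primrec_box (hf : Primrec f) : Primrec fun a => box (f a) :=
  primrec_tagged (fun _ => rfl) hf

end

/-! ### Derivability is recursively enumerable -/

/-- `x` is the instance of one of the axiom schemes of `S4I` at `a`, `b`, `c`. -/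
def AxiomInstance (a b c x : Formula) : Prop :=
  x = imp a (imp b a) ∨
  x = imp (imp a (imp b c)) (imp (imp a b) (imp a c)) ∨
  x = imp a (imp b (and a b)) ∨
  x = imp (and a b) a ∨
  x = imp (and a b) b ∨
  x = imp a (or a b) ∨
  x = imp b (or a b) ∨
  x = imp (imp a c) (imp (imp b c) (imp (or a b) c)) ∨
  x = imp bot a ∨
  x = imp (box (imp a b)) (imp (box a) (box b)) ∨
  x = imp (box (imp a b)) (imp (dia a) (dia b)) ∨
  x = imp (box a) a ∨
  x = imp a (dia a) ∨
  x = imp (box a) (box (box a)) ∨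
  x = imp (dia (dia a)) (dia a) ∨
  x = imp (dia (or a b)) (or (dia a) (dia b)) ∨
  x = imp (dia bot) bot ∨
  x = imp (box (or a b)) (or (box a) (dia b))

theorem AxiomInstance.derivable {a b c x : Formula} (h : AxiomInstance a b c x) :
    S4IDerivable x := by
  rcases h with rfl | rfl | rfl | rfl | rfl | rfl | rfl | rfl | rfl | rfl | rfl | rfl | rfl | rfl |
    rfl | rfl | rfl | rfl
  exacts [.int (.k _ _), .int (.s _ _ _), .int (.andIntro _ _), .int (.andLeft _ _),
    .int (.andRight _ _), .int (.orLeft _ _), .int (.orRight _ _), .int (.orElim _ _ _),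
    .int (.exFalso _), .cs4 (.kBox _ _), .cs4 (.kDia _ _), .cs4 (.tBox _), .cs4 (.tDia _),
    .cs4 (.fourBox _), .cs4 (.fourDia _), .s4i (.dp _ _), .s4i .n, .s4i (.cd _ _)]

theorem exists_axiomInstance {x : Formula} (h : IntAxiom x ∨ CS4Axiom x ∨ S4IAxiom x) :
    ∃ a b c, AxiomInstance a b c x := by
  unfold AxiomInstance
  rcases h with h | h | h
  · cases h with
    | k a b => exact ⟨a, b, bot, by simp⟩
    | s a b c => exact ⟨a, b, c, by simp⟩
    | andIntro a b => exact ⟨a, b, bot, by simp⟩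
    | andLeft a b => exact ⟨a, b, bot, by simp⟩
    | andRight a b => exact ⟨a, b, bot, by simp⟩
    | orLeft a b => exact ⟨a, b, bot, by simp⟩
    | orRight a b => exact ⟨a, b, bot, by simp⟩
    | orElim a b c => exact ⟨a, b, c, by simp⟩
    | exFalso a => exact ⟨a, bot, bot, by simp⟩
  · cases h with
    | kBox a b => exact ⟨a, b, bot, by simp⟩
    | kDia a b => exact ⟨a, b, bot, by simp⟩
    | tBox a => exact ⟨a, bot, bot, by simp⟩
    | tDia a => exact ⟨a, bot, bot, by simp⟩
    | fourBox a => exact ⟨a, bot, bot, by simp⟩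
    | fourDia a => exact ⟨a, bot, bot, by simp⟩
  · cases h with
    | dp a b => exact ⟨a, b, bot, by simp⟩
    | n => exact ⟨bot, bot, bot, by simp [neg]⟩
    | cd a b => exact ⟨a, b, bot, by simp⟩

/-- A line of a derivation: a rank, a formula, and three parameters for an axiom scheme. -/
abbrev Line : Type := ℕ × Formula × Formula × Formula × Formula

/-- A list of lines is a derivation if the formula of each line is an axiom instance with the
parameters of that line, or follows by a rule from lines of smaller rank. -/
def IsDerivation (D : List Line) : Prop :=
  ∀ e ∈ D, AxiomInstance e.2.2.1 e.2.2.2.1 e.2.2.2.2 e.2.1 ∨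
    (∃ d ∈ D, ∃ d' ∈ D, d.1 < e.1 ∧ d'.1 < e.1 ∧ d.2.1 = imp d'.2.1 e.2.1) ∨
    ∃ d ∈ D, d.1 < e.1 ∧ e.2.1 = box d.2.1

/-- Derivability is witnessed by a list of lines. Ranks replace positions
in the list, so derivations can be concatenated in any order. -/
theorem mem_S4I_iff_exists_derivation {φ : Formula} :
    φ ∈ S4I ↔ ∃ D, IsDerivation D ∧ ∃ e ∈ D, e.2.1 = φ := by
  constructor
  · intro h
    have hax : ∀ {x}, (IntAxiom x ∨ CS4Axiom x ∨ S4IAxiom x) →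
        ∃ D, IsDerivation D ∧ ∃ e ∈ D, e.2.1 = x := by
      intro x hx
      obtain ⟨a, b, c, h⟩ := exists_axiomInstance hx
      exact ⟨[(0, x, a, b, c)], fun e he => by simp_all, _, List.mem_singleton_self _, rfl⟩
    have hmono : ∀ {D D' : List Line} {e : Line}, D ⊆ D' →
        (AxiomInstance e.2.2.1 e.2.2.2.1 e.2.2.2.2 e.2.1 ∨
          (∃ d ∈ D, ∃ d' ∈ D, d.1 < e.1 ∧ d'.1 < e.1 ∧ d.2.1 = imp d'.2.1 e.2.1) ∨
          ∃ d ∈ D, d.1 < e.1 ∧ e.2.1 = box d.2.1) →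
        (AxiomInstance e.2.2.1 e.2.2.2.1 e.2.2.2.2 e.2.1 ∨
          (∃ d ∈ D', ∃ d' ∈ D', d.1 < e.1 ∧ d'.1 < e.1 ∧ d.2.1 = imp d'.2.1 e.2.1) ∨
          ∃ d ∈ D', d.1 < e.1 ∧ e.2.1 = box d.2.1) := by
      rintro D D' e hs (h | ⟨d, hd, d', hd', h⟩ | ⟨d, hd, h⟩)
      · exact .inl h
      · exact .inr (.inl ⟨d, hs hd, d', hs hd', h⟩)
      · exact .inr (.inr ⟨d, hs hd, h⟩)
    have hrank : ∀ D : List Line, ∃ n, ∀ d ∈ D, d.1 < n := fun D =>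
      ⟨(D.map (·.1)).sum + 1, fun d hd =>
        Nat.lt_succ_of_le (List.le_sum_of_mem (List.mem_map_of_mem hd))⟩
    change S4IDerivable φ at h
    induction h with
    | int h => exact hax (.inl h)
    | cs4 h => exact hax (.inr (.inl h))
    | s4i h => exact hax (.inr (.inr h))
    | @mp a b _ _ ih₁ ih₂ =>
      obtain ⟨D, hD, e, he, hea⟩ := ih₁
      obtain ⟨D', hD', e', he', rfl⟩ := ih₂
      obtain ⟨n, hn⟩ := hrank (D ++ D')
      have h1 : e ∈ D ++ D' := List.mem_append_left _ he
      have h2 : e' ∈ D ++ D' := List.mem_append_right _ he'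
      refine ⟨(n, b, bot, bot, bot) :: (D ++ D'), fun d hd => ?_, _, List.mem_cons_self, rfl⟩
      rcases List.mem_cons.1 hd with rfl | hd
      · exact .inr (.inl ⟨e, List.mem_cons_of_mem _ h1, e', List.mem_cons_of_mem _ h2,
          hn e h1, hn e' h2, hea⟩)
      · rcases List.mem_append.1 hd with hd | hd
        · exact hmono (fun x hx => List.mem_cons_of_mem _ (List.mem_append_left _ hx)) (hD d hd)
        · exact hmono (fun x hx => List.mem_cons_of_mem _ (List.mem_append_right _ hx)) (hD' d hd)
    | nec _ ih =>
      obtain ⟨D, hD, e, he, rfl⟩ := ih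
      obtain ⟨n, hn⟩ := hrank D
      refine ⟨(n, box e.2.1, bot, bot, bot) :: D, fun d hd => ?_, _, List.mem_cons_self, rfl⟩
      rcases List.mem_cons.1 hd with rfl | hd
      · exact .inr (.inr ⟨e, List.mem_cons_of_mem _ he, hn e he, rfl⟩)
      · exact hmono (fun x hx => List.mem_cons_of_mem _ hx) (hD d hd)
  · rintro ⟨D, hD, e, he, rfl⟩
    have : ∀ n, ∀ e ∈ D, e.1 = n → S4IDerivable e.2.1 := by
      intro n
      induction n using Nat.strong_induction_on with
      | _ n ih =>
        rintro e he rfl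
        rcases hD e he with h | ⟨d, hd, d', hd', hlt, hlt', h⟩ | ⟨d, hd, hlt, h⟩
        · exact h.derivable
        · exact .mp (h ▸ ih _ hlt d hd rfl) (ih _ hlt' d' hd' rfl)
        · exact h ▸ .nec (ih _ hlt d hd rfl)
    exact this _ e he rfl

theorem rePred_mem_S4I : REPred fun φ => φ ∈ S4I := by
  refine (rePred_exists (β := List Line)
    (p := fun φ D => IsDerivation D ∧ ∃ e ∈ D, e.2.1 = φ) ?_).of_eq
      fun φ => mem_S4I_iff_exists_derivation.symm
  -- The condition is built from equations and comparisons by connectives and bounded quantifiers.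
  unfold IsDerivation AxiomInstance
  repeat' first
    | with_reducible exact primrec_id
    | with_reducible exact Primrec.const _
    | with_reducible apply PrimrecPred.and
    | with_reducible apply PrimrecPred.or
    | with_reducible apply primrecPred_ball
    | with_reducible apply primrecPred_bex
    | with_reducible apply primrecPred_lt
    | with_reducible apply primrecPred_eq
    | with_reducible apply primrec_and
    | with_reducible apply primrec_or
    | with_reducible apply primrec_imp
    | with_reducible apply primrec_dia
    | with_reducible apply primrec_box
    | with_reducible apply primrec_fst
    | with_reducible apply primrec_snd

/-! ### Underivability is recursively enumerable -/

/-- A finite countermodel to `φ`, given by tables: `ws` lists the worlds, `le` and `acc` the pairs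
in the two relations, `sat` the worlds with the formulas they satisfy, `vars` the relevant
variables, and `forms` the relevant formulas, closed under immediate constituents. -/
def IsCountermodel (ws : List ℕ) (le acc : List (ℕ × ℕ)) (sat : List (ℕ × Formula))
    (vars : List ℕ) (forms : List Formula) (φ : Formula) : Prop :=
  (∀ w ∈ ws, (w, w) ∈ le ∧ (w, w) ∈ acc) ∧
  (∀ w ∈ ws, ∀ v ∈ ws, ∀ z ∈ ws, ((w, v) ∈ le → (v, z) ∈ le → (w, z) ∈ le) ∧
    ((w, v) ∈ acc → (v, z) ∈ acc → (w, z) ∈ acc) ∧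
    ((w, v) ∈ le → (w, z) ∈ acc → ∃ y ∈ ws, (z, y) ∈ le ∧ (v, y) ∈ acc) ∧
    ((w, v) ∈ le → (v, z) ∈ acc → ∃ y ∈ ws, (w, y) ∈ acc ∧ (y, z) ∈ le)) ∧
  (∀ w ∈ ws, ∀ v ∈ ws, ∀ q ∈ vars, (w, v) ∈ le → (w, var q) ∈ sat → (v, var q) ∈ sat) ∧
  (∀ x ∈ forms,
    (∃ q ∈ vars, x = var q) ∨
    (x = bot ∧ ∀ w ∈ ws, ¬ (w, x) ∈ sat) ∨
    (∃ a ∈ forms, ∃ b ∈ forms, x = and a b ∧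
      ∀ w ∈ ws, (w, x) ∈ sat ↔ (w, a) ∈ sat ∧ (w, b) ∈ sat) ∨
    (∃ a ∈ forms, ∃ b ∈ forms, x = or a b ∧
      ∀ w ∈ ws, (w, x) ∈ sat ↔ (w, a) ∈ sat ∨ (w, b) ∈ sat) ∨
    (∃ a ∈ forms, ∃ b ∈ forms, x = imp a b ∧
      ∀ w ∈ ws, (w, x) ∈ sat ↔ ∀ v ∈ ws, (w, v) ∈ le → (v, a) ∈ sat → (v, b) ∈ sat) ∨
    (∃ a ∈ forms, x = dia a ∧
      ∀ w ∈ ws, (w, x) ∈ sat ↔ ∃ v ∈ ws, (w, v) ∈ acc ∧ (v, a) ∈ sat) ∨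
    (∃ a ∈ forms, x = box a ∧
      ∀ w ∈ ws, (w, x) ∈ sat ↔ ∀ v ∈ ws, (w, v) ∈ acc → (v, a) ∈ sat)) ∧
  φ ∈ forms ∧ ∃ w ∈ ws, ¬ (w, φ) ∈ sat

/-- The tables define a finite `S4I` model, in which the formulas of `forms` have the tabulated
values; soundness applies. -/
theorem IsCountermodel.notMem_S4I {ws : List ℕ} {le acc : List (ℕ × ℕ)}
    {sat : List (ℕ × Formula)} {vars : List ℕ} {forms : List Formula} {φ : Formula}
    (h : IsCountermodel ws le acc sat vars forms φ) : φ ∉ S4I := by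
  obtain ⟨hrefl, htrans, hvars, hforms, hφ, w₀, hw₀, hn⟩ := h
  let F : BiIntFrame {w // w ∈ ws} :=
    { fallible := ∅
      le := fun w v => (w.1, v.1) ∈ le
      acc := fun w v => (w.1, v.1) ∈ acc
      le_refl := fun w => (hrefl w.1 w.2).1
      le_trans := fun w v z => (htrans w.1 w.2 v.1 v.2 z.1 z.2).1
      acc_refl := fun w => (hrefl w.1 w.2).2
      acc_trans := fun w v z => (htrans w.1 w.2 v.1 v.2 z.1 z.2).2.1
      fallible_le := fun _ _ h => h.elim
      fallible_acc := fun _ _ h => h.elim }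
  have hF : S4IFrames _ F := by
    refine ⟨fun w v z hwv hwz => ?_, fun w v z hwv hvz => ?_, rfl⟩
    · obtain ⟨y, hy, h⟩ := (htrans w.1 w.2 v.1 v.2 z.1 z.2).2.2.1 hwv hwz
      exact ⟨⟨y, hy⟩, h⟩
    · obtain ⟨y, hy, h⟩ := (htrans w.1 w.2 v.1 v.2 z.1 z.2).2.2.2 hwv hvz
      exact ⟨⟨y, hy⟩, h⟩
  let V : Valuation F :=
    { val := fun q => {w | q ∈ vars ∧ (w.1, var q) ∈ sat}
      monotone := fun q w v h hwv => ⟨h.1, hvars w.1 w.2 v.1 v.2 q h.1 hwv h.2⟩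
      fallible_subset := fun _ _ h => h.elim }
  have truth : ∀ x ∈ forms, ∀ w, Sat F V w x ↔ (w.1, x) ∈ sat := by
    intro x
    induction x with
    | var q =>
      intro hx w
      have hq : q ∈ vars := by have := hforms _ hx; simp_all
      exact ⟨fun h => h.2, fun h => ⟨hq, h⟩⟩
    | bot =>
      intro hx w
      have hb : ∀ w ∈ ws, ¬ (w, bot) ∈ sat := by simpa using hforms _ hx
      exact ⟨fun h => h.elim, fun h => (hb w.1 w.2 h).elim⟩
    | and a b iha ihb =>
      intro hx w
      obtain ⟨ha, hb, h⟩ : a ∈ forms ∧ b ∈ forms ∧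
          ∀ w ∈ ws, (w, and a b) ∈ sat ↔ (w, a) ∈ sat ∧ (w, b) ∈ sat := by
        have := hforms _ hx; simp_all
      rw [h w.1 w.2]
      exact and_congr (iha ha w) (ihb hb w)
    | or a b iha ihb =>
      intro hx w
      obtain ⟨ha, hb, h⟩ : a ∈ forms ∧ b ∈ forms ∧
          ∀ w ∈ ws, (w, Formula.or a b) ∈ sat ↔ (w, a) ∈ sat ∨ (w, b) ∈ sat := by
        have := hforms _ hx; simp_all
      rw [h w.1 w.2]
      exact or_congr (iha ha w) (ihb hb w)
    | imp a b iha ihb =>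
      intro hx w
      obtain ⟨ha, hb, h⟩ : a ∈ forms ∧ b ∈ forms ∧ ∀ w ∈ ws, (w, imp a b) ∈ sat ↔
          ∀ v ∈ ws, (w, v) ∈ le → (v, a) ∈ sat → (v, b) ∈ sat := by
        have := hforms _ hx; simp_all
      rw [h w.1 w.2]
      constructor
      · exact fun hw v hv hwv hva => (ihb hb ⟨v, hv⟩).1 (hw ⟨v, hv⟩ hwv ((iha ha ⟨v, hv⟩).2 hva))
      · exact fun hw v hwv hva => (ihb hb v).2 (hw v.1 v.2 hwv ((iha ha v).1 hva))
    | dia a iha =>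
      intro hx w
      obtain ⟨ha, h⟩ : a ∈ forms ∧ ∀ w ∈ ws, (w, dia a) ∈ sat ↔
          ∃ v ∈ ws, (w, v) ∈ acc ∧ (v, a) ∈ sat := by
        have := hforms _ hx; simp_all
      rw [h w.1 w.2, sat_dia_iff hF.1]
      exact ⟨fun ⟨v, hv, hva⟩ => ⟨v.1, v.2, hv, (iha ha v).1 hva⟩,
        fun ⟨v, hv, hwv, hva⟩ => ⟨⟨v, hv⟩, hwv, (iha ha ⟨v, hv⟩).2 hva⟩⟩
    | box a iha =>
      intro hx w
      obtain ⟨ha, h⟩ : a ∈ forms ∧ ∀ w ∈ ws, (w, box a) ∈ sat ↔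
          ∀ v ∈ ws, (w, v) ∈ acc → (v, a) ∈ sat := by
        have := hforms _ hx; simp_all
      rw [h w.1 w.2, sat_box_iff hF.2.1]
      exact ⟨fun hw v hv hwv => (iha ha ⟨v, hv⟩).1 (hw ⟨v, hv⟩ hwv),
        fun hw v hwv => (iha ha v).2 (hw v.1 v.2 hwv)⟩
  exact fun h => hn ((truth φ hφ ⟨w₀, hw₀⟩).1 (S4IDerivable.sound h hF V ⟨w₀, hw₀⟩))

/-- By the finite frame property, a countermodel may be taken finite; its tables are then lists. -/
theorem exists_countermodel {φ : Formula} (h : φ ∉ S4I) :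
    ∃ ws le acc sat vars forms, IsCountermodel ws le acc sat vars forms φ := by
  rw [mem_S4I_iff] at h
  simp only [Valid, Consequence, not_forall] at h
  obtain ⟨W, F, ⟨hW, hF⟩, V, w₀, -, -, hw₀⟩ := h
  obtain ⟨n, ⟨e⟩⟩ := Finite.exists_equiv_fin W
  let c : W → ℕ := fun w => e w
  have hc : ∀ {w v}, c w = c v ↔ w = v := by simp [c, Fin.val_inj]
  have hS := φ.subClosed_subformulas
  have hfin := φ.finite_subformulas
  set S := φ.subformulas
  have hlist : ∀ {β : Type} {X : Set β}, X.Finite → ∃ l : List β, ∀ x, x ∈ l ↔ x ∈ X :=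
    fun hX => ⟨hX.toFinset.toList, by simp⟩
  obtain ⟨ws, hws⟩ := hlist (Set.finite_range c)
  obtain ⟨le, hle⟩ := hlist (X := {x : ℕ × ℕ | ∃ w v, F.le w v ∧ x = (c w, c v)})
    ((Set.finite_range fun p : W × W => (c p.1, c p.2)).subset
      (by rintro _ ⟨w, v, -, rfl⟩; exact ⟨(w, v), rfl⟩))
  obtain ⟨acc, hacc⟩ := hlist (X := {x : ℕ × ℕ | ∃ w v, F.acc w v ∧ x = (c w, c v)})
    ((Set.finite_range fun p : W × W => (c p.1, c p.2)).subset
      (by rintro _ ⟨w, v, -, rfl⟩; exact ⟨(w, v), rfl⟩))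
  obtain ⟨sat, hsat⟩ := hlist (X := {x : ℕ × Formula | ∃ w, ∃ ψ ∈ S, Sat F V w ψ ∧ x = (c w, ψ)})
    (((Set.finite_range c).prod hfin).subset (by
      rintro _ ⟨w, ψ, hψ, -, rfl⟩; exact ⟨⟨w, rfl⟩, hψ⟩))
  obtain ⟨forms, hforms⟩ := hlist hfin
  obtain ⟨vars, hvars⟩ := hlist (X := {q | var q ∈ S})
    (hfin.preimage (f := var) fun a _ b _ h => by simpa using h)
  have hws' : ∀ w, c w ∈ ws := fun w => (hws _).2 ⟨w, rfl⟩
  have hall : ∀ {p : ℕ → Prop}, (∀ w ∈ ws, p w) ↔ ∀ w, p (c w) := by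
    intro p
    simp [hws]
  have hex : ∀ {p : ℕ → Prop}, (∃ w ∈ ws, p w) ↔ ∃ w, p (c w) := by
    intro p
    simp [hws]
  have hle' : ∀ w v, (c w, c v) ∈ le ↔ F.le w v := fun w v => by
    rw [hle]
    simp [hc]
  have hacc' : ∀ w v, (c w, c v) ∈ acc ↔ F.acc w v := fun w v => by
    rw [hacc]
    simp [hc]
  have hsat' : ∀ w, ∀ ψ ∈ S, (c w, ψ) ∈ sat ↔ Sat F V w ψ := fun w ψ hψ => by
    rw [hsat]
    simp [hc, hψ]
  refine ⟨ws, le, acc, sat, vars, forms, ?_, ?_, ?_, ?_, (hforms _).2 φ.self_mem_subformulas,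
    c w₀, hws' w₀, fun h => hw₀ ((hsat' w₀ φ φ.self_mem_subformulas).1 h)⟩
  · simp only [hall, hle', hacc']
    exact fun w => ⟨F.le_refl w, F.acc_refl w⟩
  · simp only [hall, hex, hle', hacc']
    exact fun w v z => ⟨F.le_trans w v z, F.acc_trans w v z, hF.1 w v z, hF.2.1 w v z⟩
  · simp only [hall, hle']
    intro w v q hq h
    rw [hvars] at hq
    rw [hsat' _ _ hq, hsat' _ _ hq]
    exact fun hw => sat_mono hw h
  · intro x hx
    simp only [hall, hex, hle', hacc']
    rw [hforms] at hx
    cases x with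
    | var q => exact .inl ⟨q, (hvars q).2 hx, rfl⟩
    | bot =>
      refine .inr (.inl ⟨rfl, fun w h => ?_⟩)
      have : w ∈ F.fallible := (hsat' w _ hx).1 h
      rw [hF.2.2] at this
      exact this
    | and a b =>
      obtain ⟨ha, hb⟩ := hS.and _ _ hx
      refine .inr (.inr (.inl ⟨a, (hforms a).2 ha, b, (hforms b).2 hb, rfl, fun w => ?_⟩))
      simp only [hsat' _ _ hx, hsat' _ _ ha, hsat' _ _ hb]
      rfl
    | or a b =>
      obtain ⟨ha, hb⟩ := hS.or _ _ hx
      refine .inr (.inr (.inr (.inl ⟨a, (hforms a).2 ha, b, (hforms b).2 hb, rfl, fun w => ?_⟩)))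
      simp only [hsat' _ _ hx, hsat' _ _ ha, hsat' _ _ hb]
      rfl
    | imp a b =>
      obtain ⟨ha, hb⟩ := hS.imp _ _ hx
      refine .inr (.inr (.inr (.inr (.inl
        ⟨a, (hforms a).2 ha, b, (hforms b).2 hb, rfl, fun w => ?_⟩))))
      simp only [hsat' _ _ hx, hsat' _ _ ha, hsat' _ _ hb]
      rfl
    | dia a =>
      have ha := hS.dia _ hx
      refine .inr (.inr (.inr (.inr (.inr (.inl ⟨a, (hforms a).2 ha, rfl, fun w => ?_⟩)))))
      simp only [hsat' _ _ hx, hsat' _ _ ha]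
      exact sat_dia_iff hF.1
    | box a =>
      have ha := hS.box _ hx
      refine .inr (.inr (.inr (.inr (.inr (.inr ⟨a, (hforms a).2 ha, rfl, fun w => ?_⟩)))))
      simp only [hsat' _ _ hx, hsat' _ _ ha]
      exact sat_box_iff hF.2.1

theorem rePred_notMem_S4I : REPred fun φ => φ ∉ S4I := by
  refine (rePred_exists (β := List ℕ × List (ℕ × ℕ) × List (ℕ × ℕ) × List (ℕ × Formula) ×
      List ℕ × List Formula)
    (p := fun φ M => IsCountermodel M.1 M.2.1 M.2.2.1 M.2.2.2.1 M.2.2.2.2.1 M.2.2.2.2.2 φ)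
    ?_).of_eq fun φ => ⟨fun ⟨_, h⟩ => h.notMem_S4I, fun h => ?_⟩
  · -- The condition is built from equations by connectives and quantifiers over lists.
    unfold IsCountermodel
    repeat' first
      | with_reducible exact primrec_id
      | with_reducible exact Primrec.const _
      | with_reducible apply PrimrecPred.and
      | with_reducible apply PrimrecPred.or
      | with_reducible apply PrimrecPred.not
      | with_reducible apply primrecPred_ball
      | with_reducible apply primrecPred_bex
      | with_reducible apply primrecPred_iff
      | with_reducible apply primrecPred_imp
      | with_reducible apply primrecPred_mem
      | with_reducible apply primrecPred_eq
      | with_reducible apply primrec_and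
      | with_reducible apply primrec_or
      | with_reducible apply primrec_imp
      | with_reducible apply primrec_dia
      | with_reducible apply primrec_box
      | with_reducible apply primrec_var
      | with_reducible apply primrec_fst
      | with_reducible apply primrec_snd
      | with_reducible apply Primrec.pair
  · obtain ⟨ws, le, acc, sat, vars, forms, h⟩ := exists_countermodel h
    exact ⟨(ws, le, acc, sat, vars, forms), h⟩

/-- `S4I` is recursively enumerable with recursively enumerable complement in the set of formulas; a
number is tested by decoding it, and rejected if it is not the code of a formula. -/
theorem decidableLogic_S4I : DecidableLogic S4I := by
  classical
  obtain ⟨hdec, h⟩ := ComputablePred.computable_iff_re_compl_re'.2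
    ⟨rePred_mem_S4I, rePred_notMem_S4I⟩
  refine ComputablePred.computable_iff.2 ⟨fun n =>
    ((Encodable.decode₂ Formula n).map fun φ => decide (φ ∈ S4I)).getD false, ?_, ?_⟩
  · refine Computable.option_getD (Computable.option_map Primrec.decode₂.to_comp ?_)
      (Computable.const _)
    exact (h.comp Computable.snd).of_eq fun _ => by congr
  · funext n
    refine propext ⟨?_, fun h => ?_⟩
    · rintro ⟨φ, hφ, rfl⟩
      rw [← encode_formula]
      simpa using hφ
    · rcases hn : Encodable.decode₂ Formula n with _ | φ
      · simp [hn] at h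
      · exact ⟨φ, by simpa [hn] using h, Encodable.decode₂_eq_some.1 hn⟩

end IntModal

/-- The logic `S4I` has the finite frame property, for falsifiability and for satisfiability, and
is decidable. -/
theorem mainTheorem6 :
    (∀ φ : IntModal.Formula, IntModal.Falsifiable IntModal.S4IFrames.{u} φ →
        IntModal.Falsifiable IntModal.FiniteS4IFrames.{v} φ) ∧
      (∀ φ : IntModal.Formula, IntModal.Satisfiable IntModal.S4IFrames.{u} φ →
        IntModal.Satisfiable IntModal.FiniteS4IFrames.{v} φ) ∧
      IntModal.DecidableLogic IntModal.S4I :=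
  ⟨fun _ => IntModal.falsifiable_finite, fun _ => IntModal.satisfiable_finite,
    IntModal.decidableLogic_S4I⟩
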